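/- **Theorem.** Let $\mu$ be a non-negative Borel measure on $[0,\infty)$, finite on bounded sets, put $M(t)=\mu([0,t])$, and suppose that $M(t)\to\infty$ as $t\to\infty$ and that $M$ is regularly varying at infinity with index $\theta\ge 0$, i.e. $M(ct)/M(t)\to c^{\theta}$ as $t\to\infty$ for every $c>0$. Let $f:(0,\infty)\to(0,\infty)$ be continuous and regularly varying at infinity with index $\beta\in[0,1)$. If $\beta=0$, suppose in addition that $f$ is asymptotically increasing (there is a nondecreasing function $\varphi$ with $f(y)/\varphi(y)\to 1$ as $y\to\infty$) and that $\lim_{y\to\infty}f(y)=\infty$. Let $h$ be locally integrable on $[0,\infty)$ and suppose that $H(t):=\int_0^t h(s)\,ds>0$ for all $t>0$ ($h$ itself may change sign). Let $\xi>0$ and let $x:[0,\infty)\to(0,\infty)$ be a solution of $$x'(t)=\int_{[0,t]}\mu(ds)\,f(x(t-s))+h(t),\quad t>0;\qquad x(0)=\xi ,$$ that is, $x$ is locally absolutely continuous on $[0,\infty)$, $x(0)=\xi$, and the equation holds for almost every $t>0$. Let $F(y)=\int_1^y du/f(u)$ for $y>0$, let $F^{-1}$ be the inverse of the function $F$ on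 $(0,\infty)$, let $B(a,b)=\int_0^1 r^{a-1}(1-r)^{b-1}\,dr$ be the Beta function, and put $$L=\left\{\frac{1}{1-\beta}\,B\!\left(1+\theta,\frac{1+\theta\beta}{1-\beta}\right)\right\}^{1/(1-\beta)} .$$ Then the following are equivalent: (i) the limit $\displaystyle\lim_{t\to\infty}\frac{x(t)}{F^{-1}(tM(t))}=\zeta$ exists for some $\zeta\in[L,\infty)$; (ii) the limit $\displaystyle\lim_{t\to\infty}\frac{H(t)}{F^{-1}(tM(t))}=\lambda$ exists for some $\lambda\in[0,\infty)$. Moreover, in that case $$\zeta=\frac{\zeta^{\beta}}{1-\beta}\,B\!\left(1+\theta,\frac{1+\theta\beta}{1-\beta}\right)+\lambda ,$$ and $\zeta$ is the only positive solution of this equation. -/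

import Mathlib

open MeasureTheory Filter Topology Set

namespace SublinearVolterra

/-- `g ∈ RV_∞(ρ)`: `g` is measurable and positive near infinity, and
`g (c x) / g x → c ^ ρ` as `x → ∞` for every `c > 0`. Only the behaviour of `g` on some half-line
`[a, ∞)` enters, so functions given on `[0, ∞)` or `(0, ∞)` only are covered. -/
structure IsRegularlyVarying (g : ℝ → ℝ) (ρ : ℝ) : Prop where
  measurable : ∃ a : ℝ, Measurable (fun x : Ici a => g x)
  eventually_pos : ∀ᶠ x in atTop, 0 < g x
  tendsto_div : ∀ c : ℝ, 0 < c → Tendsto (fun x => g (c * x) / g x) atTop (𝓝 (c ^ ρ))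

/-- `g` is asymptotic at infinity to an increasing (that is, nondecreasing) function. -/
def AsymptoticallyIncreasing (g : ℝ → ℝ) : Prop :=
  ∃ φ : ℝ → ℝ, Monotone φ ∧ Tendsto (fun x => g x / φ x) atTop (𝓝 1)

/-- `M(t) = ∫_{[0,t]} μ(ds)`. -/
noncomputable def cumulative (μ : Measure ℝ) (t : ℝ) : ℝ :=
  ∫ _s in Icc 0 t, (1 : ℝ) ∂μ

/-- `H(t) = ∫_0^t h(s) ds`. -/
noncomputable def forcing (h : ℝ → ℝ) (t : ℝ) : ℝ :=
  ∫ s in (0 : ℝ)..t, h s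

/-- `F(x) = ∫_1^x du / f(u)`, for `x > 0`. -/
noncomputable def F (f : ℝ → ℝ) (x : ℝ) : ℝ :=
  ∫ u in (1 : ℝ)..x, 1 / f u

/-- The inverse of `F` regarded as a function on `(0, ∞)`. -/
noncomputable def Finv (f : ℝ → ℝ) : ℝ → ℝ :=
  Function.invFunOn (F f) (Ioi 0)

/-- `x : [0, ∞) → (0, ∞)` solves `x'(t) = ∫_{[0,t]} μ(ds) f(x(t-s)) + h(t)`, `t > 0`, `x(0) = ξ`.
Since `μ` may have atoms, the right-hand side may jump; as usual, a solution is locally absolutely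
continuous and satisfies the equation for almost every `t > 0`. -/
structure IsSolution (μ : Measure ℝ) (f h : ℝ → ℝ) (ξ : ℝ) (x : ℝ → ℝ) : Prop where
  initial : x 0 = ξ
  pos : ∀ t : ℝ, 0 ≤ t → 0 < x t
  absolutelyContinuous : ∀ T : ℝ, 0 < T → AbsolutelyContinuousOnInterval x 0 T
  equation : ∀ᵐ t : ℝ, 0 < t →
    HasDerivAt x ((∫ s in Icc 0 t, f (x (t - s)) ∂μ) + h t) t

/-- `K = B(1 + θ, (1 + θ β) / (1 - β)) / (1 - β)`, with `B` the Beta function. -/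
noncomputable def K (θ β : ℝ) : ℝ :=
  ProbabilityTheory.beta (1 + θ) ((1 + θ * β) / (1 - β)) / (1 - β)

/-- `L = {B(1 + θ, (1 + θ β) / (1 - β)) / (1 - β)} ^ (1 / (1 - β))`. -/
noncomputable def L (θ β : ℝ) : ℝ :=
  K θ β ^ (1 / (1 - β))

end SublinearVolterra

/-!
Write `M = cumulative μ` and `G(t) = F⁻¹(t M(t))`. By Fubini the equation integrates to
`x(t) = ξ + ∫_0^t M(t - s) f(x(s)) ds + H(t)`, and the whole argument takes place there.

The scale `G` is the right one because of two facts. Karamata's theorem,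
`F(y) ∼ y / ((1 - β) f(y))`, gives `t M(t) f(G(t)) ∼ G(t) / (1 - β)`. Moreover `G` and `f ∘ G` are
regularly varying with indices `(1 + θ) / (1 - β)` and `β (1 + θ) / (1 - β)`, so that dominated
convergence in `∫_0^1 M(t (1 - r)) f(G(t r)) dr`, after division by `M(t) f(G(t))`, produces the
Beta integral: `∫_0^t M(t - s) f(G(s)) ds ∼ K G(t)` (`tendsto_volterra_comp_scale`). Changing the
integrand on a bounded set costs `O(M(t)) = o(G(t))`, so asymptotic upper and lower bounds for
`f ∘ x` in terms of `f ∘ G` pass to the convolution. If `x ∼ ζ G`, then `f ∘ x ∼ ζ ^ β (f ∘ G)` by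
the uniform convergence theorem, and hence `H / G → ζ - K ζ ^ β`.

Conversely, let `H / G → λ`. Sublinearity (Potter's bound `f(w) ≤ C (w / z) ^ p f(z)` with `p < 1`)
confines `x / G` to a compact subset of `(0, ∞)`: from above by looking at a maximum point of `x` on
`[0, t]` (`exists_le_mul_scale`), from below by a recursion from `t / 2` to `t` whose gain `c m ^ p`
exceeds `m` for small `m` (`exists_mul_scale_le`). Then `a = liminf x / G` and `b = limsup x / G`
satisfy `K a ^ β + λ ≤ a` and `b ≤ K b ^ β + λ`. Since `z ↦ K z ^ (β - 1) + λ / z` is strictly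
decreasing, `a = b` (`eq_of_fixedPoint_inequalities`), which gives the limit, its equation and the
uniqueness of the positive solution.

For `f` merely continuous, uniform convergence follows from Baire's theorem applied to
`u ↦ log f(e ^ u) - β u`. Monotonicity of `f` is used only in the weak form `f(z) ≤ C f(w)` for
`z ≤ w`, which regular variation supplies if `β > 0` and asymptotic monotonicity if `β = 0`.
-/

namespace SublinearVolterra

/-! ### Uniform convergence and Potter bounds -/

/-- Pointwise convergence of the increments of a continuous function is uniform on some interval
`[0, δ]`: by Baire's theorem one of the closed sets of increments `v` that are small for all `u ≥ n`
contains an interval, and the difference of two points of it is an increment again. -/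
theorem exists_uniform_increment_small {k : ℝ → ℝ} (hk : Continuous k)
    (hlim : ∀ v : ℝ, Tendsto (fun u => k (u + v) - k u) atTop (𝓝 0)) {ε : ℝ} (hε : 0 < ε) :
    ∃ δ > 0, ∀ᶠ u in atTop, ∀ w ∈ Icc 0 δ, |k (u + w) - k u| ≤ ε := by
  let A : ℕ → Set ℝ := fun n => {v | ∀ u : ℝ, (n : ℝ) ≤ u → |k (u + v) - k u| ≤ ε / 2}
  have hA_closed : ∀ n, IsClosed (A n) := by
    intro n
    have : A n = ⋂ u : ℝ, ⋂ _ : (n : ℝ) ≤ u, {v | |k (u + v) - k u| ≤ ε / 2} := by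
      ext v; simp [A]
    rw [this]
    refine isClosed_iInter fun u => isClosed_iInter fun _ => isClosed_le ?_ continuous_const
    fun_prop
  have hA_univ : ⋃ n, A n = univ := by
    refine eq_univ_of_forall fun v => mem_iUnion.2 ?_
    have h1 : ∀ᶠ u in atTop, |k (u + v) - k u| < ε / 2 := by
      have := (hlim v).abs
      rw [abs_zero] at this
      exact this.eventually (gt_mem_nhds (half_pos hε))
    obtain ⟨N, hN⟩ := eventually_atTop.1 h1
    obtain ⟨n, hn⟩ := exists_nat_ge N
    exact ⟨n, fun u hu => (hN u (hn.trans hu)).le⟩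
  obtain ⟨n, a, ha⟩ := nonempty_interior_of_iUnion_of_closed hA_closed hA_univ
  obtain ⟨δ, hδ, hball⟩ := Metric.mem_nhds_iff.1 (mem_interior_iff_mem_nhds.1 ha)
  refine ⟨δ / 2, half_pos hδ, ?_⟩
  filter_upwards [eventually_ge_atTop ((n : ℝ) + a)] with u hu w hw
  have h1 : a + w ∈ A n := hball (by
    rw [Metric.mem_ball, Real.dist_eq, abs_lt]; constructor <;> linarith [hw.1, hw.2])
  have h2 : a ∈ A n := hball (Metric.mem_ball_self hδ)
  have e1 := h1 (u - a) (by linarith)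
  have e2 := h2 (u - a) (by linarith)
  rw [show u - a + (a + w) = u + w by ring] at e1
  rw [show u - a + a = u by ring] at e2
  rw [abs_le] at *
  constructor <;> linarith [e1.1, e1.2, e2.1, e2.2]

/-- Uniform smallness of the increments on a compact interval. The interval is extended in steps of
length `δ`; pointwise convergence at the grid points keeps the errors from accumulating. -/
theorem eventually_increment_small {k : ℝ → ℝ} (hk : Continuous k)
    (hlim : ∀ v : ℝ, Tendsto (fun u => k (u + v) - k u) atTop (𝓝 0)) {ε : ℝ} (hε : 0 < ε)
    (a b : ℝ) : ∀ᶠ u in atTop, ∀ w ∈ Icc a b, |k (u + w) - k u| ≤ ε := by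
  obtain ⟨δ, hδ, hsmall⟩ := exists_uniform_increment_small hk hlim (half_pos hε)
  have hpt : ∀ v, ∀ᶠ u in atTop, |k (u + v) - k u| ≤ ε / 2 := by
    intro v
    have := (hlim v).abs
    rw [abs_zero] at this
    exact (this.eventually (gt_mem_nhds (half_pos hε))).mono fun u hu => hu.le
  have key : ∀ n : ℕ, ∀ᶠ u in atTop, ∀ w ∈ Icc a (a + n * δ), |k (u + w) - k u| ≤ ε := by
    intro n
    induction n with
    | zero =>
      filter_upwards [hpt a] with u hu w hw
      have : w = a := le_antisymm (by simpa using hw.2) hw.1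
      rw [this]; linarith
    | succ n ih =>
      have hshift : ∀ᶠ u in atTop, ∀ w ∈ Icc 0 δ,
          |k (u + (a + n * δ) + w) - k (u + (a + n * δ))| ≤ ε / 2 :=
        (tendsto_atTop_add_const_right atTop (a + n * δ) tendsto_id).eventually hsmall
      filter_upwards [ih, hpt (a + n * δ), hshift] with u h1 h2 h3 w hw
      rcases le_total w (a + n * δ) with hle | hle
      · exact h1 w ⟨hw.1, hle⟩
      · have e := h3 (w - (a + n * δ)) ⟨by linarith, by
          have := hw.2; push_cast at this; linarith⟩
        rw [show u + (a + n * δ) + (w - (a + n * δ)) = u + w by ring] at e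
        rw [abs_le] at *
        constructor <;> linarith [e.1, e.2, h2.1, h2.2]
  obtain ⟨n, hn⟩ := exists_nat_ge ((b - a) / δ)
  rw [div_le_iff₀ hδ] at hn
  filter_upwards [key n] with u hu w hw
  exact hu w ⟨hw.1, by linarith [hw.2]⟩

/-- The uniform convergence theorem for continuous regularly varying functions, in multiplicative
form: `f (c y)` and `c ^ β f y` agree up to a factor `q`, uniformly for `c` in a compact set. -/
theorem IsRegularlyVarying.eventually_uniform {f : ℝ → ℝ} {β : ℝ}
    (hf_cont : ContinuousOn f (Ioi 0)) (hf_pos : ∀ y : ℝ, 0 < y → 0 < f y)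
    (hf : IsRegularlyVarying f β) {a b q : ℝ} (ha : 0 < a) (hq : 1 < q) :
    ∀ᶠ y in atTop, ∀ c ∈ Icc a b, f (c * y) ≤ q * c ^ β * f y ∧ c ^ β * f y ≤ q * f (c * y) := by
  let k : ℝ → ℝ := fun u => Real.log (f (Real.exp u)) - β * u
  have hk : Continuous k := by
    have h1 : Continuous fun u => f (Real.exp u) :=
      hf_cont.comp_continuous Real.continuous_exp fun u => Real.exp_pos u
    exact (h1.log fun u => (hf_pos _ (Real.exp_pos u)).ne').sub (by fun_prop)
  have hfk : ∀ y, 0 < y → f y = Real.exp (k (Real.log y)) * y ^ β := by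
    intro y hy
    simp only [k]
    rw [Real.exp_log hy, Real.exp_sub, Real.exp_log (hf_pos y hy), Real.rpow_def_of_pos hy,
      mul_comm β, div_mul_cancel₀ _ (Real.exp_pos _).ne']
  have hlim : ∀ v : ℝ, Tendsto (fun u => k (u + v) - k u) atTop (𝓝 0) := by
    intro v
    have h1 := (hf.tendsto_div (Real.exp v) (Real.exp_pos v)).comp Real.tendsto_exp_atTop
    have h2 := (h1.log (Real.rpow_pos_of_pos (Real.exp_pos v) β).ne').sub_const (β * v)
    rw [Real.log_rpow (Real.exp_pos v), Real.log_exp, sub_self] at h2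
    refine h2.congr fun u => ?_
    simp only [Function.comp, k]
    rw [Real.log_div (hf_pos _ (by positivity)).ne' (hf_pos _ (by positivity)).ne', Real.exp_add,
      mul_comm (Real.exp v)]
    ring
  have hev := Real.tendsto_log_atTop.eventually
    (eventually_increment_small hk hlim (Real.log_pos hq) (Real.log a) (Real.log b))
  filter_upwards [hev, eventually_gt_atTop 0] with y hy hy0 c hc
  have hc0 : 0 < c := ha.trans_le hc.1
  have hw := hy (Real.log c) ⟨Real.log_le_log ha hc.1, Real.log_le_log hc0 hc.2⟩
  rw [abs_le] at hw
  have hq0 : 0 < q := by linarith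
  have hqe : q = Real.exp (Real.log q) := (Real.exp_log hq0).symm
  have e1 : Real.exp (k (Real.log y + Real.log c)) ≤ q * Real.exp (k (Real.log y)) := by
    conv_rhs => rw [hqe, ← Real.exp_add]
    exact Real.exp_le_exp.2 (by linarith [hw.2])
  have e2 : Real.exp (k (Real.log y)) ≤ q * Real.exp (k (Real.log y + Real.log c)) := by
    conv_rhs => rw [hqe, ← Real.exp_add]
    exact Real.exp_le_exp.2 (by linarith [hw.1])
  rw [hfk y hy0, hfk (c * y) (mul_pos hc0 hy0), Real.log_mul hc0.ne' hy0.ne',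
    add_comm (Real.log c), Real.mul_rpow hc0.le hy0.le]
  have hp : 0 < c ^ β * y ^ β := by positivity
  constructor
  · calc _ ≤ q * Real.exp (k (Real.log y)) * (c ^ β * y ^ β) :=
        mul_le_mul_of_nonneg_right e1 hp.le
      _ = _ := by ring
  · calc _ = Real.exp (k (Real.log y)) * (c ^ β * y ^ β) := by ring
      _ ≤ q * Real.exp (k (Real.log y + Real.log c)) * (c ^ β * y ^ β) :=
        mul_le_mul_of_nonneg_right e2 hp.le
      _ = _ := by ring

/-- A growth bound along doublings `y ↦ 2 y`, together with a crude bound within one doubling,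
gives a power bound. -/
theorem le_rpow_mul_of_doubling {g : ℝ → ℝ} {X A p : ℝ} (hX : 0 < X) (hp : 0 ≤ p)
    (hA : 0 ≤ A) (hg : ∀ y, X ≤ y → 0 ≤ g y) (h2 : ∀ y, X ≤ y → g (2 * y) ≤ 2 ^ p * g y)
    (hc : ∀ y, X ≤ y → ∀ c ∈ Icc (1 : ℝ) 2, g (c * y) ≤ A * g y)
    {z w : ℝ} (hz : X ≤ z) (hzw : z ≤ w) : g w ≤ A * (w / z) ^ p * g z := by
  have key : ∀ n : ℕ, ∀ z, X ≤ z → ∀ w, z ≤ w → w ≤ 2 ^ (n + 1) * z →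
      g w ≤ A * (w / z) ^ p * g z := by
    intro n
    induction n with
    | zero =>
      intro z hz w hzw hw
      have hz0 := hX.trans_le hz
      have h1 : 1 ≤ w / z := (one_le_div hz0).2 hzw
      have e := hc z hz (w / z) ⟨h1, (div_le_iff₀ hz0).2 (by simpa using hw)⟩
      rw [div_mul_cancel₀ _ hz0.ne'] at e
      have := Real.one_le_rpow h1 hp
      calc g w ≤ A * g z := e
        _ = A * 1 * g z := by ring
        _ ≤ _ := by have := hg z hz; gcongr
    | succ n ih =>
      intro z hz w hzw hw
      have hz0 := hX.trans_le hz
      rcases le_total w (2 ^ (n + 1) * z) with hle | hle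
      · exact ih z hz w hzw hle
      · have h2z : 2 * z ≤ w := by
          refine le_trans ?_ hle
          gcongr
          exact le_self_pow₀ (by norm_num) (by omega)
        have e := ih (2 * z) (by linarith) w h2z (by rw [pow_succ] at hw; linarith)
        have hw0 : 0 < w := by linarith
        calc g w ≤ A * (w / (2 * z)) ^ p * g (2 * z) := e
          _ ≤ A * (w / (2 * z)) ^ p * (2 ^ p * g z) := by
            gcongr; exact h2 z hz
          _ = A * ((w / (2 * z)) ^ p * 2 ^ p) * g z := by ring
          _ = _ := by
            rw [← Real.mul_rpow (by positivity) (by norm_num)]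
            congr 3; field_simp
  have hz0 := hX.trans_le hz
  obtain ⟨n, hn⟩ := pow_unbounded_of_one_lt (w / z) (by norm_num : (1 : ℝ) < 2)
  refine key n z hz w hzw ?_
  rw [div_lt_iff₀ hz0] at hn
  refine hn.le.trans ?_
  gcongr
  · norm_num
  · omega

/-- A power bound valid on some half-line extends to `[y₀, ∞)` for every `y₀ > 0`, since a positive
continuous function is bounded above and below on compact sets. -/
theorem exists_const_le_rpow_mul {g : ℝ → ℝ} {X A p : ℝ} (hg_cont : ContinuousOn g (Ioi 0))
    (hg_pos : ∀ y : ℝ, 0 < y → 0 < g y) (hp : 0 ≤ p) (hX : 0 < X)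
    (h : ∀ z w, X ≤ z → z ≤ w → g w ≤ A * (w / z) ^ p * g z) {y₀ : ℝ} (hy₀ : 0 < y₀) :
    ∃ C > 0, ∀ z w, y₀ ≤ z → z ≤ w → g w ≤ C * (w / z) ^ p * g z := by
  have hsub : Icc y₀ (max y₀ X) ⊆ Ioi 0 := fun u hu => hy₀.trans_le hu.1
  have hne : (Icc y₀ (max y₀ X)).Nonempty := nonempty_Icc.2 (le_max_left _ _)
  obtain ⟨u, hu, hmin⟩ := isCompact_Icc.exists_isMinOn hne (hg_cont.mono hsub)
  obtain ⟨v, hv, hmax⟩ := isCompact_Icc.exists_isMaxOn hne (hg_cont.mono hsub)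
  have hgu := hg_pos u (hsub hu)
  have hgv := hg_pos v (hsub hv)
  have hX' : X ≤ max y₀ X := le_max_right _ _
  set X' := max y₀ X
  have hX'0 : 0 < X' := hX.trans_le hX'
  have hA : 0 < A := by
    have := h X X le_rfl le_rfl
    rw [div_self hX.ne', Real.one_rpow, mul_one] at this
    have h0 := hg_pos X hX
    by_contra hcon
    nlinarith
  have huv : g u ≤ g v := hmin hv
  refine ⟨(1 + A) * (g v / g u), by positivity, fun z w hz hzw => ?_⟩
  have hz0 := hy₀.trans_le hz
  have hw0 := hz0.trans_le hzw
  have h1 : 1 ≤ (w / z) ^ p := Real.one_le_rpow ((one_le_div hz0).2 hzw) hp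
  have hgz := hg_pos z hz0
  rcases le_total X' z with hz' | hz'
  · calc g w ≤ A * (w / z) ^ p * g z := h z w (hX'.trans hz') hzw
      _ ≤ _ := by
        have : 1 ≤ g v / g u := (one_le_div hgu).2 huv
        gcongr
        nlinarith
  · have hguz : g u ≤ g z := hmin (⟨hz, hz'⟩ : z ∈ Icc y₀ X')
    have hvz : g v ≤ g v / g u * g z := by
      rw [div_mul_eq_mul_div, le_div_iff₀ hgu]; gcongr
    rcases le_total w X' with hw' | hw'
    · have hgw : g w ≤ g v := hmax (⟨hz.trans hzw, hw'⟩ : w ∈ Icc y₀ X')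
      calc g w ≤ 1 * 1 * (g v / g u * g z) := by linarith
        _ ≤ (1 + A) * (w / z) ^ p * (g v / g u * g z) := by gcongr; linarith
        _ = _ := by ring
    · have hgX : g X' ≤ g v := hmax (⟨le_max_left _ _, le_rfl⟩ : X' ∈ Icc y₀ X')
      have hmono : (w / X') ^ p ≤ (w / z) ^ p := by gcongr
      calc g w ≤ A * (w / X') ^ p * g X' := h X' w hX' hw'
        _ ≤ (1 + A) * (w / z) ^ p * (g v / g u * g z) := by
          have := hg_pos X' hX'0
          gcongr
          · linarith
          · exact hgX.trans hvz
        _ = _ := by ring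

/-- Potter's upper bound, with a constant that works on all of `[y₀, ∞)`. -/
theorem IsRegularlyVarying.exists_potter {f : ℝ → ℝ} {β : ℝ}
    (hf_cont : ContinuousOn f (Ioi 0)) (hf_pos : ∀ y : ℝ, 0 < y → 0 < f y) (hβ : 0 ≤ β)
    (hf : IsRegularlyVarying f β) {p : ℝ} (hp : β < p) {y₀ : ℝ} (hy₀ : 0 < y₀) :
    ∃ C > 0, ∀ z w, y₀ ≤ z → z ≤ w → f w ≤ C * (w / z) ^ p * f z := by
  have h1 : ∀ᶠ y in atTop, f (2 * y) ≤ 2 ^ p * f y := by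
    have hlt : (2 : ℝ) ^ β < 2 ^ p := Real.rpow_lt_rpow_of_exponent_lt (by norm_num) hp
    filter_upwards [(hf.tendsto_div 2 (by norm_num)).eventually (gt_mem_nhds hlt),
      eventually_gt_atTop 0] with y hy hy0
    exact ((div_lt_iff₀ (hf_pos y hy0)).1 hy).le
  obtain ⟨X, hX⟩ := eventually_atTop.1 (h1.and (hf.eventually_uniform hf_cont hf_pos
    (a := 1) (b := 2) (q := 2) one_pos (by norm_num)))
  have hX0 : 0 < max X 1 := by positivity
  refine exists_const_le_rpow_mul (A := 2 * 2 ^ β) hf_cont hf_pos (by linarith) hX0 ?_ hy₀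
  intro z w hz hzw
  refine le_rpow_mul_of_doubling hX0 (by linarith) (by positivity)
    (fun y hy => (hf_pos y (hX0.trans_le hy)).le)
    (fun y hy => (hX y ((le_max_left _ _).trans hy)).1) ?_ hz hzw
  intro y hy c hc
  refine ((hX y ((le_max_left _ _).trans hy)).2 c hc).1.trans ?_
  have := (hf_pos y (hX0.trans_le hy)).le
  have := hc.1
  gcongr
  exact hc.2

/-- Monotonicity up to a constant factor. If `β > 0` this is the doubling bound with `p = 0` for
`1 / f`, since `f (2 y) ≥ f y` eventually. -/
theorem IsRegularlyVarying.exists_almost_monotone {f : ℝ → ℝ} {β : ℝ}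
    (hf_cont : ContinuousOn f (Ioi 0)) (hf_pos : ∀ y : ℝ, 0 < y → 0 < f y) (hβ : 0 ≤ β)
    (hf : IsRegularlyVarying f β) (hf_zero : β = 0 → AsymptoticallyIncreasing f)
    {y₀ : ℝ} (hy₀ : 0 < y₀) :
    ∃ C > 0, ∀ z w, y₀ ≤ z → z ≤ w → f z ≤ C * f w := by
  have key : ∃ X A : ℝ, 0 < X ∧ ∀ z w, X ≤ z → z ≤ w → (f w)⁻¹ ≤ A * (f z)⁻¹ := by
    rcases hβ.eq_or_lt with h0 | hpos
    · obtain ⟨φ, hφ, hlim⟩ := hf_zero h0.symm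
      have hev : ∀ᶠ y in atTop, 0 < f y → f y ≤ 2 * φ y ∧ φ y ≤ 2 * f y := by
        filter_upwards [hlim.eventually (gt_mem_nhds (by norm_num : (1 : ℝ) < 2)),
          hlim.eventually (lt_mem_nhds (by norm_num : (1 / 2 : ℝ) < 1))] with y h2 h1 hy
        have hφy : 0 < φ y := by
          by_contra hcon
          have := div_nonpos_of_nonneg_of_nonpos hy.le (not_lt.1 hcon)
          linarith
        rw [div_lt_iff₀ hφy] at h2
        rw [lt_div_iff₀ hφy] at h1
        constructor <;> linarith
      obtain ⟨X, hX⟩ := eventually_atTop.1 hev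
      refine ⟨max X 1, 4, by positivity, fun z w hz hzw => ?_⟩
      have hz0 : 0 < z := lt_of_lt_of_le (by positivity) hz
      have hfz := hf_pos z hz0
      have hfw := hf_pos w (hz0.trans_le hzw)
      have hzX := (le_max_left X 1).trans hz
      have h1 := (hX z hzX hfz).1
      have h2 := (hX w (hzX.trans hzw) hfw).2
      have h3 := hφ hzw
      rw [← div_eq_mul_inv, inv_le_iff_one_le_mul₀ hfw, div_mul_eq_mul_div, le_div_iff₀ hfz]
      linarith
    · have h1 : ∀ᶠ y in atTop, 0 < y → f y ≤ f (2 * y) := by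
        have hlt : (1 : ℝ) < 2 ^ β := Real.one_lt_rpow (by norm_num) hpos
        filter_upwards [(hf.tendsto_div 2 (by norm_num)).eventually (lt_mem_nhds hlt)] with y hy hy0
        exact ((one_lt_div (hf_pos y hy0)).1 hy).le
      obtain ⟨X, hX⟩ := eventually_atTop.1 (h1.and (hf.eventually_uniform hf_cont hf_pos
        (a := 1) (b := 2) (q := 2) one_pos (by norm_num)))
      have hX0 : 0 < max X 1 := by positivity
      refine ⟨max X 1, 2, hX0, fun z w hz hzw => ?_⟩
      have := le_rpow_mul_of_doubling (g := fun y => (f y)⁻¹) (p := 0) (A := 2) hX0 le_rfl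
        (by norm_num) (fun y hy => (inv_pos.2 (hf_pos y (hX0.trans_le hy))).le)
        (fun y hy => ?_) (fun y hy c hc => ?_) hz hzw
      · simpa using this
      · have hy0 := hX0.trans_le hy
        have := (hX y ((le_max_left _ _).trans hy)).1 hy0
        rw [Real.rpow_zero, one_mul]
        exact inv_anti₀ (hf_pos y hy0) this
      · have hy0 := hX0.trans_le hy
        have hfy := hf_pos y hy0
        have hfc := hf_pos (c * y) (mul_pos (by linarith [hc.1]) hy0)
        have h2 := ((hX y ((le_max_left _ _).trans hy)).2 c hc).2
        have h3 := Real.one_le_rpow hc.1 hβ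
        rw [← div_eq_mul_inv, inv_le_iff_one_le_mul₀ hfc, div_mul_eq_mul_div, le_div_iff₀ hfy]
        nlinarith
  obtain ⟨X, A, hX, hA⟩ := key
  obtain ⟨C, hC, h⟩ := exists_const_le_rpow_mul (g := fun y => (f y)⁻¹) (p := 0) (A := A)
    (hf_cont.inv₀ fun y hy => (hf_pos y hy).ne') (fun y hy => inv_pos.2 (hf_pos y hy)) le_rfl hX
    (by simpa using hA) hy₀
  refine ⟨C, hC, fun z w hz hzw => ?_⟩
  have hz0 := hy₀.trans_le hz
  have hfz := hf_pos z hz0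
  have hfw := hf_pos w (hz0.trans_le hzw)
  have := h z w hz hzw
  simp only [Real.rpow_zero, mul_one] at this
  rw [← div_eq_mul_inv, inv_le_iff_one_le_mul₀ hfw, div_mul_eq_mul_div, le_div_iff₀ hfz] at this
  linarith

/-! ### Asymptotics of `F` and its inverse -/

/-- The assumptions on the nonlinearity: `f` is continuous and positive on `(0, ∞)`, regularly
varying with index `β ∈ [0, 1)`, and asymptotically increasing if `β = 0`. -/
structure IsSublinearGrowth (f : ℝ → ℝ) (β : ℝ) : Prop where
  cont : ContinuousOn f (Ioi 0)
  pos : ∀ y : ℝ, 0 < y → 0 < f y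
  nonneg : 0 ≤ β
  lt_one : β < 1
  regular : IsRegularlyVarying f β
  asymptoticallyIncreasing : β = 0 → AsymptoticallyIncreasing f

namespace IsSublinearGrowth

variable {f : ℝ → ℝ} {β : ℝ}

theorem one_sub_pos (hf : IsSublinearGrowth f β) : 0 < 1 - β := by linarith [hf.lt_one]

theorem exists_almost_monotone (hf : IsSublinearGrowth f β) {y₀ : ℝ} (hy₀ : 0 < y₀) :
    ∃ C > 0, ∀ z w, y₀ ≤ z → z ≤ w → f z ≤ C * f w :=
  hf.regular.exists_almost_monotone hf.cont hf.pos hf.nonneg hf.asymptoticallyIncreasing hy₀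

theorem exists_potter (hf : IsSublinearGrowth f β) {y₀ : ℝ} (hy₀ : 0 < y₀) :
    ∃ p : ℝ, 0 < p ∧ p < 1 ∧ ∃ C > 0, ∀ z w, y₀ ≤ z → z ≤ w → f w ≤ C * (w / z) ^ p * f z :=
  ⟨(1 + β) / 2, by linarith [hf.nonneg], by linarith [hf.lt_one],
    hf.regular.exists_potter hf.cont hf.pos hf.nonneg (by linarith [hf.lt_one]) hy₀⟩

/-- If `u / v → c` and `v → ∞`, then `f ∘ u / f ∘ v → c ^ β`, by uniform convergence. -/
theorem tendsto_comp_div (hf : IsSublinearGrowth f β) {ι : Type*} {l : Filter ι} {u v : ι → ℝ}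
    {c : ℝ} (hc : 0 < c) (hv : Tendsto v l atTop) (huv : Tendsto (fun t => u t / v t) l (𝓝 c)) :
    Tendsto (fun t => f (u t) / f (v t)) l (𝓝 (c ^ β)) := by
  have hcont : Tendsto (fun t => (u t / v t) ^ β) l (𝓝 (c ^ β)) :=
    huv.rpow_const (Or.inl hc.ne')
  have hcp : 0 < c ^ β := Real.rpow_pos_of_pos hc β
  have hIcc : ∀ᶠ t in l, u t / v t ∈ Icc (c / 2) (2 * c) :=
    huv.eventually (Icc_mem_nhds (by linarith) (by linarith))
  have hpos : ∀ᶠ t in l, 0 < v t := hv.eventually (eventually_gt_atTop 0)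
  have hev : ∀ q : ℝ, 1 < q → ∀ᶠ t in l, f (u t) / f (v t) ≤ q * (u t / v t) ^ β ∧
      (u t / v t) ^ β / q ≤ f (u t) / f (v t) := by
    intro q hq
    filter_upwards [hIcc, hpos, hv.eventually (hf.regular.eventually_uniform hf.cont hf.pos
      (a := c / 2) (b := 2 * c) (by linarith) hq)] with t h1 h2 h3
    have := h3 _ h1
    rw [div_mul_cancel₀ _ h2.ne'] at this
    rw [div_le_iff₀ (hf.pos _ h2), div_le_div_iff₀ (by linarith) (hf.pos _ h2)]
    exact ⟨this.1, by linarith [this.2]⟩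
  refine tendsto_order.2 ⟨fun a ha => ?_, fun a ha => ?_⟩
  · obtain ⟨q, hq1, hq⟩ : ∃ q : ℝ, 1 < q ∧ a < c ^ β / q := by
      have : Tendsto (fun q : ℝ => c ^ β / q) (𝓝[>] 1) (𝓝 (c ^ β / 1)) :=
        (tendsto_const_nhds.div tendsto_id one_ne_zero).mono_left nhdsWithin_le_nhds
      rw [div_one] at this
      obtain ⟨q, h1, h2⟩ := ((this.eventually (lt_mem_nhds ha)).and self_mem_nhdsWithin).exists
      exact ⟨q, h2, h1⟩
    filter_upwards [hev q hq1, (hcont.div_const q).eventually (lt_mem_nhds hq)] with t h1 h2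
    exact h2.trans_le h1.2
  · obtain ⟨q, hq1, hq⟩ : ∃ q : ℝ, 1 < q ∧ q * c ^ β < a := by
      have : Tendsto (fun q : ℝ => q * c ^ β) (𝓝[>] 1) (𝓝 (1 * c ^ β)) :=
        (tendsto_id.mul_const _).mono_left nhdsWithin_le_nhds
      rw [one_mul] at this
      obtain ⟨q, h1, h2⟩ := ((this.eventually (gt_mem_nhds ha)).and self_mem_nhdsWithin).exists
      exact ⟨q, h2, h1⟩
    filter_upwards [hev q hq1, (hcont.const_mul q).eventually (gt_mem_nhds hq)] with t h1 h2
    exact h1.1.trans_lt h2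

theorem intervalIntegrable_inv (hf : IsSublinearGrowth f β) {a b : ℝ} (ha : 0 < a) (hb : 0 < b) :
    IntervalIntegrable (fun u => 1 / f u) volume a b := by
  refine ContinuousOn.intervalIntegrable ?_
  have hsub : uIcc a b ⊆ Ioi 0 := fun u hu => (lt_min ha hb).trans_le hu.1
  exact continuousOn_const.div (hf.cont.mono hsub) fun u hu => (hf.pos u (hsub hu)).ne'

theorem F_sub (hf : IsSublinearGrowth f β) {a b : ℝ} (ha : 0 < a) (hb : 0 < b) :
    F f b - F f a = ∫ u in a..b, 1 / f u :=
  intervalIntegral.integral_interval_sub_left (hf.intervalIntegrable_inv one_pos hb)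
    (hf.intervalIntegrable_inv one_pos ha)

theorem strictMonoOn_F (hf : IsSublinearGrowth f β) : StrictMonoOn (F f) (Ioi 0) := by
  intro a ha b hb hab
  rw [← sub_pos, hf.F_sub ha hb]
  refine intervalIntegral.intervalIntegral_pos_of_pos_on (hf.intervalIntegrable_inv ha hb) ?_ hab
  intro u hu
  exact one_div_pos.2 (hf.pos u (lt_trans ha hu.1))

theorem continuousOn_F (hf : IsSublinearGrowth f β) {b : ℝ} (hb : 1 ≤ b) :
    ContinuousOn (F f) (Icc 1 b) := by
  have := intervalIntegral.continuousOn_primitive_interval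
    (f := fun u => 1 / f u) (μ := volume) (a := 1) (b := b) (by
      have := (intervalIntegrable_iff_integrableOn_Icc_of_le hb).1
        (hf.intervalIntegrable_inv one_pos (by linarith))
      rwa [uIcc_of_le hb])
  rwa [uIcc_of_le hb] at this

theorem F_one (f : ℝ → ℝ) : F f 1 = 0 := intervalIntegral.integral_same

/-- Karamata's theorem `F(y) ∼ y / ((1 - β) f(y))`. With `u` rescaled by `y`, the left side is
`∫_{1/y}^1 f(y) / f(u y) du`, which tends to `∫_0^1 u ^ (-β) du`; Potter's bound dominates it by
`C u ^ (-p)` with `p < 1`. -/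
theorem tendsto_F_mul_div (hf : IsSublinearGrowth f β) :
    Tendsto (fun y => F f y * f y / y) atTop (𝓝 (1 / (1 - β))) := by
  obtain ⟨p, hp0, hp1, C, hC, hpot⟩ := hf.exists_potter one_pos
  have hlim : Tendsto (fun y => ∫ u in Ioc (0 : ℝ) 1,
      (Ioc (1 / y) 1).indicator (fun u => f y / f (u * y)) u) atTop
      (𝓝 (∫ u in Ioc (0 : ℝ) 1, u ^ (-β))) := by
    refine tendsto_integral_filter_of_dominated_convergence (fun u => C * u ^ (-p)) ?_ ?_ ?_ ?_
    · filter_upwards [eventually_gt_atTop 0] with y hy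
      have hcont : ContinuousOn (fun u => f y / f (u * y)) (Ioc (1 / y) 1) := by
        have hpos : ∀ u ∈ Ioc (1 / y) 1, 0 < u * y := fun u hu =>
          mul_pos ((one_div_pos.2 hy).trans hu.1) hy
        exact continuousOn_const.div (hf.cont.comp (by fun_prop) hpos)
          fun u hu => (hf.pos _ (hpos u hu)).ne'
      exact ((aestronglyMeasurable_indicator_iff measurableSet_Ioc).2
        (hcont.aestronglyMeasurable measurableSet_Ioc)).restrict
    · filter_upwards [eventually_gt_atTop 0] with y hy
      filter_upwards [ae_restrict_mem measurableSet_Ioc] with u hu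
      rw [indicator_apply]
      have hu0 : 0 < u := hu.1
      split_ifs with hmem
      · have huy : 1 ≤ u * y := ((div_lt_iff₀ hy).1 hmem.1).le
        have hfy := hf.pos y hy
        have hfu := hf.pos (u * y) (by linarith)
        rw [Real.norm_of_nonneg (by positivity), div_le_iff₀ hfu]
        refine (hpot (u * y) y huy (by nlinarith [hu.2])).trans_eq ?_
        rw [show y / (u * y) = u⁻¹ by field_simp, Real.inv_rpow hu0.le, Real.rpow_neg hu0.le]
      · rw [norm_zero]; positivity
    · have := (intervalIntegral.intervalIntegrable_rpow' (a := 0) (b := 1)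
        (by linarith : -1 < -p)).const_mul C
      exact (intervalIntegrable_iff_integrableOn_Ioc_of_le zero_le_one).1 this
    · filter_upwards [ae_restrict_mem measurableSet_Ioc] with u hu
      have hu0 : 0 < u := hu.1
      have h1 := (hf.regular.tendsto_div u hu0).inv₀ (Real.rpow_pos_of_pos hu0 β).ne'
      rw [← Real.rpow_neg hu0.le] at h1
      refine h1.congr' ?_
      filter_upwards [eventually_gt_atTop (1 / u), eventually_gt_atTop 0] with y hy hy0
      rw [indicator_of_mem, inv_div]
      exact ⟨(one_div_lt hu0 hy0).1 hy, hu.2⟩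
  have hval : ∫ u in Ioc (0 : ℝ) 1, u ^ (-β) = 1 / (1 - β) := by
    rw [← intervalIntegral.integral_of_le zero_le_one, integral_rpow
      (Or.inl (by linarith [hf.lt_one])), Real.one_rpow, Real.zero_rpow (by linarith [hf.lt_one]),
      sub_zero, neg_add_eq_sub]
  rw [hval] at hlim
  refine hlim.congr' ?_
  filter_upwards [eventually_ge_atTop 1] with y hy
  have hy0 : 0 < y := by linarith
  have hsub : Ioc (1 / y) 1 ⊆ Ioc (0 : ℝ) 1 := Ioc_subset_Ioc_left (by positivity)
  rw [setIntegral_indicator measurableSet_Ioc, inter_eq_right.2 hsub,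
    ← intervalIntegral.integral_of_le ((div_le_one hy0).2 hy)]
  have := intervalIntegral.integral_comp_mul_right (a := 1 / y) (b := 1)
    (fun u => f y / f u) hy0.ne'
  rw [this, one_div_mul_cancel hy0.ne', one_mul]
  simp only [div_eq_mul_inv (f y)]
  rw [intervalIntegral.integral_const_mul, F]
  simp only [one_div, smul_eq_mul]
  ring

theorem tendsto_div_atTop (hf : IsSublinearGrowth f β) : Tendsto (fun y => y / f y) atTop atTop := by
  obtain ⟨p, hp0, hp1, C, hC, hpot⟩ := hf.exists_potter one_pos
  have hf1 := hf.pos 1 one_pos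
  have h1 : Tendsto (fun y : ℝ => (C * f 1)⁻¹ * y ^ (1 - p)) atTop atTop :=
    (tendsto_rpow_atTop (by linarith)).const_mul_atTop (by positivity)
  refine tendsto_atTop_mono' _ ?_ h1
  filter_upwards [eventually_ge_atTop 1] with y hy
  have hy0 : 0 < y := by linarith
  have := hpot 1 y le_rfl hy
  rw [div_one] at this
  rw [le_div_iff₀ (hf.pos y hy0), Real.rpow_sub hy0, Real.rpow_one]
  calc _ ≤ (C * f 1)⁻¹ * (y / y ^ p) * (C * y ^ p * f 1) := by gcongr
    _ = y := by field_simp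

theorem tendsto_F_atTop (hf : IsSublinearGrowth f β) : Tendsto (F f) atTop atTop := by
  have h := hf.tendsto_F_mul_div.pos_mul_atTop (one_div_pos.2 hf.one_sub_pos) hf.tendsto_div_atTop
  refine h.congr' ?_
  filter_upwards [eventually_gt_atTop 0] with y hy
  have := (hf.pos y hy).ne'
  field_simp

theorem tendsto_F_div (hf : IsSublinearGrowth f β) {c : ℝ} (hc : 0 < c) :
    Tendsto (fun y => F f (c * y) / F f y) atTop (𝓝 (c ^ (1 - β))) := by
  have h1 := hf.tendsto_F_mul_div
  have h2 := h1.comp (tendsto_id.const_mul_atTop hc)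
  have h0 : 1 / (1 - β) ≠ 0 := (one_div_pos.2 hf.one_sub_pos).ne'
  have hcp := Real.rpow_pos_of_pos hc β
  have h3 := ((h2.div h1 h0).div (hf.regular.tendsto_div c hc) hcp.ne').mul_const c
  rw [div_self h0, one_div, ← Real.rpow_neg hc.le, mul_comm, ← Real.rpow_one_add' hc.le
    (by linarith [hf.lt_one])] at h3
  refine h3.congr' ?_
  filter_upwards [eventually_gt_atTop 0, hf.tendsto_F_atTop.eventually (eventually_gt_atTop 0)]
    with y hy hF
  have e1 := (hf.pos y hy).ne'
  have e2 := (hf.pos _ (mul_pos hc hy)).ne'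
  have e3 := hF.ne'
  have e4 := hc.ne'
  have e5 := hy.ne'
  simp only [Function.comp, id, Pi.div_apply]
  field_simp

theorem exists_F_eq (hf : IsSublinearGrowth f β) {s : ℝ} (hs : 0 ≤ s) : ∃ y ∈ Ioi 0, F f y = s := by
  obtain ⟨b, hb, hb1⟩ := ((hf.tendsto_F_atTop.eventually (eventually_ge_atTop s)).and
    (eventually_ge_atTop 1)).exists
  obtain ⟨y, hy, hys⟩ := intermediate_value_Icc hb1 (hf.continuousOn_F hb1)
    (show s ∈ Icc (F f 1) (F f b) from ⟨by rwa [F_one], hb⟩)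
  exact ⟨y, lt_of_lt_of_le one_pos hy.1, hys⟩

theorem F_Finv (hf : IsSublinearGrowth f β) {s : ℝ} (hs : 0 ≤ s) : F f (Finv f s) = s :=
  Function.invFunOn_eq (hf.exists_F_eq hs)

theorem Finv_pos (hf : IsSublinearGrowth f β) {s : ℝ} (hs : 0 ≤ s) : 0 < Finv f s :=
  Function.invFunOn_mem (hf.exists_F_eq hs)

theorem le_Finv_iff (hf : IsSublinearGrowth f β) {s y : ℝ} (hs : 0 ≤ s) (hy : 0 < y) :
    y ≤ Finv f s ↔ F f y ≤ s := by
  conv_rhs => rw [← hf.F_Finv hs]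
  exact (hf.strictMonoOn_F.le_iff_le hy (hf.Finv_pos hs)).symm

theorem one_le_Finv (hf : IsSublinearGrowth f β) {s : ℝ} (hs : 0 ≤ s) : 1 ≤ Finv f s := by
  rwa [hf.le_Finv_iff hs one_pos, F_one]

theorem monotoneOn_Finv (hf : IsSublinearGrowth f β) : MonotoneOn (Finv f) (Ici 0) := by
  intro s hs t ht hst
  rwa [hf.le_Finv_iff ht (hf.Finv_pos hs), hf.F_Finv hs]

theorem tendsto_Finv_atTop (hf : IsSublinearGrowth f β) : Tendsto (Finv f) atTop atTop := by
  refine tendsto_atTop.2 fun b => ?_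
  filter_upwards [eventually_ge_atTop 0, eventually_ge_atTop (F f (max b 1))] with s hs hb
  exact (le_max_left b 1).trans ((hf.le_Finv_iff hs (by positivity)).2 hb)

/-- `F⁻¹` is regularly varying with index `1 / (1 - β)`, along arbitrary `u ∼ c v`. Since `F` is
strictly increasing, `F⁻¹(u) / F⁻¹(v)` is compared with `d` by comparing `u` with `F(d F⁻¹(v))`. -/
theorem tendsto_Finv_div (hf : IsSublinearGrowth f β) {ι : Type*} {l : Filter ι} {u v : ι → ℝ}
    {c : ℝ} (hc : 0 < c) (hv : Tendsto v l atTop) (huv : Tendsto (fun t => u t / v t) l (𝓝 c)) :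
    Tendsto (fun t => Finv f (u t) / Finv f (v t)) l (𝓝 (c ^ (1 / (1 - β)))) := by
  have hβ := hf.one_sub_pos
  have hv0 : ∀ᶠ t in l, 0 < v t := hv.eventually (eventually_gt_atTop 0)
  have hu0 : ∀ᶠ t in l, 0 < u t := by
    filter_upwards [hv0, huv.eventually (lt_mem_nhds hc)] with t h1 h2
    exact (div_pos_iff_of_pos_right h1).1 h2
  have hFd : ∀ d : ℝ, 0 < d →
      Tendsto (fun t => F f (d * Finv f (v t)) / v t) l (𝓝 (d ^ (1 - β))) := by
    intro d hd
    refine ((hf.tendsto_F_div hd).comp (hf.tendsto_Finv_atTop.comp hv)).congr' ?_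
    filter_upwards [hv0] with t ht
    simp only [Function.comp]
    rw [hf.F_Finv ht.le]
  have hcp : 0 < c ^ (1 / (1 - β)) := Real.rpow_pos_of_pos hc _
  have hcc : (c ^ (1 / (1 - β))) ^ (1 - β) = c := by
    rw [← Real.rpow_mul hc.le, one_div_mul_cancel hβ.ne', Real.rpow_one]
  refine tendsto_order.2 ⟨fun d hd => ?_, fun d hd => ?_⟩
  · rcases le_or_gt d 0 with hd0 | hd0
    · filter_upwards [hv0, hu0] with t h1 h2
      exact hd0.trans_lt (div_pos (hf.Finv_pos h2.le) (hf.Finv_pos h1.le))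
    · have hlt : d ^ (1 - β) < c := by
        rw [← hcc]; exact Real.rpow_lt_rpow hd0.le hd hβ
      filter_upwards [hv0, hu0, (hFd d hd0).eventually_lt huv hlt] with t h1 h2 h3
      rw [div_lt_div_iff_of_pos_right h1] at h3
      rw [lt_div_iff₀ (hf.Finv_pos h1.le)]
      rw [← hf.F_Finv h2.le] at h3
      exact (hf.strictMonoOn_F.lt_iff_lt (mul_pos hd0 (hf.Finv_pos h1.le)) (hf.Finv_pos h2.le)).1 h3
  · have hd0 : 0 < d := hcp.trans hd
    have hlt : c < d ^ (1 - β) := by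
      conv_lhs => rw [← hcc]
      exact Real.rpow_lt_rpow hcp.le hd hβ
    filter_upwards [hv0, hu0, huv.eventually_lt (hFd d hd0) hlt] with t h1 h2 h3
    rw [div_lt_div_iff_of_pos_right h1] at h3
    rw [div_lt_iff₀ (hf.Finv_pos h1.le)]
    rw [← hf.F_Finv h2.le] at h3
    exact (hf.strictMonoOn_F.lt_iff_lt (hf.Finv_pos h2.le) (mul_pos hd0 (hf.Finv_pos h1.le))).1 h3

end IsSublinearGrowth

/-! ### The integrated equation -/

theorem cumulative_eq (μ : Measure ℝ) (t : ℝ) : cumulative μ t = μ.real (Icc 0 t) := by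
  simp [cumulative]

theorem cumulative_nonneg (μ : Measure ℝ) (t : ℝ) : 0 ≤ cumulative μ t := by
  rw [cumulative_eq]; exact measureReal_nonneg

theorem cumulative_mono {μ : Measure ℝ} (hμ : ∀ t : ℝ, μ (Icc 0 t) < ⊤) :
    Monotone (cumulative μ) := by
  intro s t hst
  rw [cumulative_eq, cumulative_eq]
  exact measureReal_mono (Icc_subset_Icc_right hst) (hμ t).ne

/-- The convolution `∫_0^t M(t - s) k(s) ds` with the cumulative function of `μ`. -/
noncomputable def volterra (μ : Measure ℝ) (k : ℝ → ℝ) (t : ℝ) : ℝ :=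
  ∫ s in (0 : ℝ)..t, cumulative μ (t - s) * k s

/-- The primitive of `s ↦ ∫_{[0,s]} k(s - u) μ(du)` is `∫_0^t M(t - s) k(s) ds`: swap the integrals,
substitute `v = s - u`, and swap back. -/
theorem integral_convolution_eq_volterra {μ : Measure ℝ} (hμ : ∀ t : ℝ, μ (Icc 0 t) < ⊤)
    {k : ℝ → ℝ} (hk : Continuous k) {t : ℝ} (ht : 0 ≤ t) :
    IntervalIntegrable (fun s => ∫ u in Icc 0 s, k (s - u) ∂μ) volume 0 t ∧
      ∫ s in (0 : ℝ)..t, ∫ u in Icc 0 s, k (s - u) ∂μ = volterra μ k t := by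
  have : IsFiniteMeasure (μ.restrict (Icc 0 t)) := ⟨by simpa using hμ t⟩
  set ν := μ.restrict (Icc 0 t) with hν
  have hself : ν.restrict (Icc 0 t) = ν := by
    rw [hν, Measure.restrict_restrict measurableSet_Icc, inter_self]
  have hbound : ∃ C, ∀ v ∈ Icc (-t) t, ‖k v‖ ≤ C :=
    isCompact_Icc.exists_bound_of_continuousOn hk.continuousOn
  obtain ⟨C, hC⟩ := hbound
  have hC0 : 0 ≤ C := (norm_nonneg _).trans (hC 0 ⟨by linarith, ht⟩)
  let ρ := (volume : Measure ℝ).restrict (Ioc 0 t)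
  -- `A` and `B` are the integrands before and after the substitution, cut off to `u ≤ s` and to
  -- `u + v ≤ t`; both are bounded, so they are integrable for the finite product measure.
  let A : ℝ → ℝ → ℝ := fun s u => (Iic s).indicator (fun u => k (s - u)) u
  have hmeasA : Measurable (Function.uncurry A) := by
    have : Function.uncurry A = {q : ℝ × ℝ | q.2 ≤ q.1}.indicator (fun q => k (q.1 - q.2)) := by
      ext ⟨s, u⟩; simp [A, indicator_apply]
    rw [this]
    exact (by fun_prop : Measurable fun q : ℝ × ℝ => k (q.1 - q.2)).indicator
      (measurableSet_le measurable_snd measurable_fst)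
  have hae : ∀ᵐ q ∂(ρ.prod ν), q.1 ∈ Ioc 0 t ∧ q.2 ∈ Icc 0 t := by
    rw [← hself, Measure.prod_restrict]
    exact ae_restrict_mem (measurableSet_Ioc.prod measurableSet_Icc)
  have hintA : Integrable (Function.uncurry A) (ρ.prod ν) := by
    refine Integrable.of_bound hmeasA.aestronglyMeasurable C ?_
    filter_upwards [hae] with q hq
    simp only [Function.uncurry, A, indicator_apply]
    split_ifs with h
    · refine hC _ ⟨?_, ?_⟩ <;> linarith [hq.1.1, hq.1.2, hq.2.1, hq.2.2]
    · simpa using hC0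
  let B : ℝ → ℝ → ℝ := fun u v => {u : ℝ | u + v ≤ t}.indicator (fun _ => k v) u
  have hmeasB : Measurable (Function.uncurry B) := by
    have : Function.uncurry B = {q : ℝ × ℝ | q.1 + q.2 ≤ t}.indicator (fun q => k q.2) := by
      ext ⟨s, u⟩; simp [B, indicator_apply]
    rw [this]
    exact (by fun_prop : Measurable fun q : ℝ × ℝ => k q.2).indicator
      (measurableSet_le (by fun_prop) measurable_const)
  have hae' : ∀ᵐ q ∂(ν.prod ρ), q.1 ∈ Icc 0 t ∧ q.2 ∈ Ioc 0 t := by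
    rw [← hself, Measure.prod_restrict]
    exact ae_restrict_mem (measurableSet_Icc.prod measurableSet_Ioc)
  have hintB : Integrable (Function.uncurry B) (ν.prod ρ) := by
    refine Integrable.of_bound hmeasB.aestronglyMeasurable C ?_
    filter_upwards [hae'] with q hq
    simp only [Function.uncurry, B, indicator_apply]
    split_ifs with h
    · refine hC _ ⟨?_, ?_⟩ <;> linarith [hq.2.1, hq.2.2]
    · simpa using hC0
  have hinner : ∀ s ∈ Ioc 0 t, ∫ u in Icc 0 s, k (s - u) ∂μ = ∫ u, A s u ∂ν := by
    intro s hs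
    rw [integral_indicator measurableSet_Iic, hν, Measure.restrict_restrict measurableSet_Iic]
    congr 2
    ext u
    simp only [mem_Icc, mem_inter_iff, mem_Iic]
    constructor
    · rintro ⟨h1, h2⟩; exact ⟨h2, h1, h2.trans hs.2⟩
    · rintro ⟨h1, h2, h3⟩; exact ⟨h2, h1⟩
  have hmid : ∀ u ∈ Icc 0 t, ∫ s, A s u ∂ρ = ∫ v, B u v ∂ρ := by
    intro u hu
    have e1 : ∫ s, A s u ∂ρ = ∫ s in u..t, k (s - u) := by
      have : (fun s => A s u) = (Ici u).indicator fun s => k (s - u) := by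
        ext s; simp [A, indicator_apply]
      have hset : (Ici u ∩ Ioc 0 t : Set ℝ) =ᵐ[volume] (Ioc u t : Set ℝ) := by
        have h2 : Ioi u ∩ Ioc 0 t = Ioc u t := by
          ext v
          simp only [mem_inter_iff, mem_Ioi, mem_Ioc]
          constructor
          · rintro ⟨h1, h2, h3⟩; exact ⟨h1, h3⟩
          · rintro ⟨h1, h2⟩; exact ⟨h1, hu.1.trans_lt h1, h2⟩
        rw [← h2]
        exact Ioi_ae_eq_Ici.symm.inter (ae_eq_refl _)
      rw [this, integral_indicator measurableSet_Ici, Measure.restrict_restrict measurableSet_Ici,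
        intervalIntegral.integral_of_le hu.2, setIntegral_congr_set hset]
    have e2 : ∫ v, B u v ∂ρ = ∫ v in (0 : ℝ)..(t - u), k v := by
      have : B u = (Iic (t - u)).indicator fun v => k v := by
        ext v; simp [B, indicator_apply, le_sub_iff_add_le, add_comm]
      rw [this, integral_indicator measurableSet_Iic, Measure.restrict_restrict measurableSet_Iic,
        intervalIntegral.integral_of_le (by linarith [hu.2])]
      congr 2
      ext v
      simp only [mem_inter_iff, mem_Iic, mem_Ioc]
      constructor
      · rintro ⟨h1, h2, h3⟩; exact ⟨h2, h1⟩
      · rintro ⟨h1, h2⟩; exact ⟨h2, h1, by linarith [hu.1]⟩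
    rw [e1, e2, intervalIntegral.integral_comp_sub_right (fun v => k v), sub_self]
  have hlast : ∀ v ∈ Ioc 0 t, ∫ u, B u v ∂ν = cumulative μ (t - v) * k v := by
    intro v hv
    have : (fun u => B u v) = (Iic (t - v)).indicator fun _ => k v := by
      ext u; simp [B, indicator_apply, le_sub_iff_add_le]
    rw [this, integral_indicator measurableSet_Iic, setIntegral_const, hν, smul_eq_mul,
      cumulative_eq, measureReal_restrict_apply measurableSet_Iic]
    congr 2
    ext u
    simp only [mem_inter_iff, mem_Iic, mem_Icc]
    constructor
    · rintro ⟨h1, h2, h3⟩; exact ⟨h2, h1⟩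
    · rintro ⟨h1, h2⟩; exact ⟨h2, h1, by linarith [hv.1]⟩
  constructor
  · rw [intervalIntegrable_iff_integrableOn_Ioc_of_le ht]
    exact hintA.integral_prod_left.congr
      ((ae_restrict_mem measurableSet_Ioc).mono fun s hs => (hinner s hs).symm)
  · rw [volterra, intervalIntegral.integral_of_le ht, intervalIntegral.integral_of_le ht,
      setIntegral_congr_fun measurableSet_Ioc hinner]
    calc ∫ s, (∫ u, A s u ∂ν) ∂ρ = ∫ u, (∫ s, A s u ∂ρ) ∂ν := integral_integral_swap hintA
      _ = ∫ u, (∫ v, B u v ∂ρ) ∂ν := setIntegral_congr_fun measurableSet_Icc hmid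
      _ = ∫ v, (∫ u, B u v ∂ν) ∂ρ := integral_integral_swap hintB
      _ = _ := setIntegral_congr_fun measurableSet_Ioc hlast

namespace IsSolution

variable {μ : Measure ℝ} {f h x : ℝ → ℝ} {ξ : ℝ}

theorem continuousOn (hx : IsSolution μ f h ξ x) : ContinuousOn x (Ici 0) := by
  intro t ht
  have h1 := (hx.absolutelyContinuous (t + 1) (by linarith [mem_Ici.1 ht])).continuousOn
  rw [uIcc_of_le (by linarith [mem_Ici.1 ht])] at h1
  refine (h1 t ⟨ht, by linarith⟩).mono_of_mem_nhdsWithin ?_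
  rw [← Ici_inter_Iic]
  exact inter_mem_nhdsWithin _ (Iic_mem_nhds (by linarith))

theorem continuousOn_comp (hx : IsSolution μ f h ξ x) (hf : ContinuousOn f (Ioi 0)) :
    ContinuousOn (fun t => f (x t)) (Ici 0) :=
  hf.comp hx.continuousOn fun t ht => hx.pos t ht

/-- The integrated equation. -/
theorem eq_add (hx : IsSolution μ f h ξ x) (hμ : ∀ t : ℝ, μ (Icc 0 t) < ⊤)
    (hf : ContinuousOn f (Ioi 0)) (hh : ∀ T : ℝ, 0 < T → IntervalIntegrable h volume 0 T)
    {t : ℝ} (ht : 0 < t) :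
    x t = ξ + volterra μ (fun s => f (x s)) t + forcing h t := by
  -- `f ∘ x` is continued to negative times by a constant
  let k : ℝ → ℝ := fun v => f (x (max v 0))
  have hk : Continuous k := (hx.continuousOn_comp hf).comp_continuous (by fun_prop)
    fun v => le_max_right v 0
  obtain ⟨hint, heq⟩ := integral_convolution_eq_volterra hμ hk ht.le
  have hvol : volterra μ (fun s => f (x s)) t = volterra μ k t := by
    refine intervalIntegral.integral_congr fun s hs => ?_
    rw [uIcc_of_le ht.le] at hs
    simp [k, hs.1]
  have hderiv : ∫ s in (0 : ℝ)..t, deriv x s =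
      ∫ s in (0 : ℝ)..t, ((∫ u in Icc 0 s, k (s - u) ∂μ) + h s) := by
    refine intervalIntegral.integral_congr_ae ?_
    filter_upwards [hx.equation] with s hs hmem
    rw [uIoc_of_le ht.le] at hmem
    rw [(hs hmem.1).deriv]
    congr 1
    refine setIntegral_congr_fun measurableSet_Icc fun u hu => ?_
    simp [k, hu.2]
  rw [(hx.absolutelyContinuous t ht).integral_deriv_eq_sub, hx.initial,
    intervalIntegral.integral_add hint (hh t ht), heq, ← hvol] at hderiv
  rw [forcing]
  linarith

end IsSolution

/-! ### The scale `F⁻¹(t M(t))` and its convolution with the kernel -/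

/-- The assumptions on the measure: it is finite on bounded sets, and its cumulative function tends
to infinity and is regularly varying with index `θ ≥ 0`. -/
structure IsGrowingKernel (μ : Measure ℝ) (θ : ℝ) : Prop where
  finite : ∀ t : ℝ, μ (Icc 0 t) < ⊤
  tendsto : Tendsto (cumulative μ) atTop atTop
  nonneg : 0 ≤ θ
  regular : IsRegularlyVarying (cumulative μ) θ

/-- The comparison function `G(t) = F⁻¹(t M(t))`. -/
noncomputable def scale (μ : Measure ℝ) (f : ℝ → ℝ) (t : ℝ) : ℝ :=
  Finv f (t * cumulative μ t)

section Scale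

variable {μ : Measure ℝ} {f : ℝ → ℝ} {θ β : ℝ}

theorem IsGrowingKernel.tendsto_mul (hμ : IsGrowingKernel μ θ) :
    Tendsto (fun t => t * cumulative μ t) atTop atTop :=
  tendsto_id.atTop_mul_atTop₀ hμ.tendsto

theorem IsGrowingKernel.tendsto_mul_div (hμ : IsGrowingKernel μ θ) {r : ℝ} (hr : 0 < r) :
    Tendsto (fun t => (r * t * cumulative μ (r * t)) / (t * cumulative μ t)) atTop
      (𝓝 (r ^ (1 + θ))) := by
  rw [Real.rpow_one_add' hr.le (by linarith [hμ.nonneg])]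
  refine ((hμ.regular.tendsto_div r hr).const_mul r).congr' ?_
  filter_upwards [eventually_gt_atTop 0] with t ht
  rw [mul_assoc, mul_div_assoc, mul_div_mul_left _ _ ht.ne']

theorem mul_cumulative_nonneg (μ : Measure ℝ) {t : ℝ} (ht : 0 ≤ t) : 0 ≤ t * cumulative μ t :=
  mul_nonneg ht (cumulative_nonneg μ t)

theorem one_le_scale (hf : IsSublinearGrowth f β) {t : ℝ} (ht : 0 ≤ t) : 1 ≤ scale μ f t :=
  hf.one_le_Finv (mul_cumulative_nonneg μ ht)

theorem scale_pos (hf : IsSublinearGrowth f β) {t : ℝ} (ht : 0 ≤ t) : 0 < scale μ f t :=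
  zero_lt_one.trans_le (one_le_scale hf ht)

theorem scale_mono (hμ : IsGrowingKernel μ θ) (hf : IsSublinearGrowth f β) {s t : ℝ} (hs : 0 ≤ s)
    (hst : s ≤ t) : scale μ f s ≤ scale μ f t :=
  hf.monotoneOn_Finv (mul_cumulative_nonneg μ hs) (mul_cumulative_nonneg μ (hs.trans hst))
    (mul_le_mul hst (cumulative_mono hμ.finite hst) (cumulative_nonneg μ s) (hs.trans hst))

theorem tendsto_scale_atTop (hμ : IsGrowingKernel μ θ) (hf : IsSublinearGrowth f β) :
    Tendsto (scale μ f) atTop atTop :=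
  hf.tendsto_Finv_atTop.comp hμ.tendsto_mul

theorem tendsto_scale_div (hμ : IsGrowingKernel μ θ) (hf : IsSublinearGrowth f β) {r : ℝ}
    (hr : 0 < r) : Tendsto (fun t => scale μ f (r * t) / scale μ f t) atTop
      (𝓝 (r ^ ((1 + θ) / (1 - β)))) := by
  have := hf.tendsto_Finv_div (Real.rpow_pos_of_pos hr (1 + θ)) hμ.tendsto_mul
    (hμ.tendsto_mul_div hr)
  rwa [← Real.rpow_mul hr.le, mul_one_div] at this

theorem tendsto_comp_scale_div (hμ : IsGrowingKernel μ θ) (hf : IsSublinearGrowth f β) {r : ℝ}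
    (hr : 0 < r) : Tendsto (fun t => f (scale μ f (r * t)) / f (scale μ f t)) atTop
      (𝓝 (r ^ ((1 + θ) / (1 - β) * β))) := by
  have := hf.tendsto_comp_div (Real.rpow_pos_of_pos hr _) (tendsto_scale_atTop hμ hf)
    (tendsto_scale_div hμ hf hr)
  rwa [← Real.rpow_mul hr.le] at this

theorem tendsto_mul_comp_scale_div (hμ : IsGrowingKernel μ θ) (hf : IsSublinearGrowth f β) :
    Tendsto (fun t => t * cumulative μ t * f (scale μ f t) / scale μ f t) atTop
      (𝓝 (1 / (1 - β))) := by
  refine (hf.tendsto_F_mul_div.comp (tendsto_scale_atTop hμ hf)).congr' ?_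
  filter_upwards [eventually_ge_atTop 0] with t ht
  simp only [Function.comp]
  rw [scale, hf.F_Finv (mul_cumulative_nonneg μ ht)]

theorem tendsto_cumulative_div_scale (hμ : IsGrowingKernel μ θ) (hf : IsSublinearGrowth f β) :
    Tendsto (fun t => cumulative μ t / scale μ f t) atTop (𝓝 0) := by
  obtain ⟨C, hC, hmono⟩ := hf.exists_almost_monotone one_pos
  have hf1 := hf.pos 1 one_pos
  have h1 : Tendsto (fun t => t * f (scale μ f t)) atTop atTop := by
    refine tendsto_atTop_mono' _ ?_ (tendsto_id.atTop_mul_const (div_pos hf1 hC))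
    filter_upwards [eventually_ge_atTop 0] with t ht
    have := hmono 1 _ le_rfl (one_le_scale (μ := μ) hf ht)
    simp only [id]
    gcongr
    rwa [div_le_iff₀' hC]
  refine ((tendsto_mul_comp_scale_div hμ hf).div_atTop h1).congr' ?_
  filter_upwards [eventually_gt_atTop 0] with t ht
  have h2 := scale_pos (μ := μ) hf ht.le
  have h3 := hf.pos _ h2
  field_simp

theorem measurable_cumulative (hμ : IsGrowingKernel μ θ) : Measurable (cumulative μ) :=
  (cumulative_mono hμ.finite).measurable

/-- A measurable function on the whole line that agrees with `f ∘ G` on `[0, ∞)`. -/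
theorem exists_measurable_eq_comp_scale (hμ : IsGrowingKernel μ θ) (hf : IsSublinearGrowth f β) :
    ∃ g : ℝ → ℝ, Measurable g ∧ ∀ t, 0 ≤ t → f (scale μ f t) = g t := by
  have h1 : Monotone fun t => scale μ f (max t 0) := fun s t hst =>
    scale_mono hμ hf (le_max_right s 0) (max_le_max_right 0 hst)
  have h2 : Continuous fun y => f (max y 1) :=
    hf.cont.comp_continuous (by fun_prop) fun y => lt_of_lt_of_le one_pos (le_max_right y 1)
  refine ⟨fun t => f (max (scale μ f (max t 0)) 1), h2.measurable.comp h1.measurable,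
    fun t ht => ?_⟩
  simp only [max_eq_left ht, max_eq_left (one_le_scale hf ht)]

theorem intervalIntegrable_comp_scale (hμ : IsGrowingKernel μ θ) (hf : IsSublinearGrowth f β)
    {t : ℝ} (ht : 0 ≤ t) : IntervalIntegrable (fun s => f (scale μ f s)) volume 0 t := by
  obtain ⟨g, hg, heq⟩ := exists_measurable_eq_comp_scale hμ hf
  obtain ⟨C, hC, hmono⟩ := hf.exists_almost_monotone one_pos
  rw [intervalIntegrable_iff_integrableOn_Ioc_of_le ht]
  refine IntegrableOn.congr_fun ?_ (fun s hs => (heq s hs.1.le).symm) measurableSet_Ioc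
  refine Integrable.of_bound hg.aestronglyMeasurable (C * f (scale μ f t)) ?_
  filter_upwards [ae_restrict_mem measurableSet_Ioc] with s hs
  rw [← heq s hs.1.le, Real.norm_of_nonneg (hf.pos _ (scale_pos hf hs.1.le)).le]
  exact hmono _ _ (one_le_scale hf hs.1.le) (scale_mono hμ hf hs.1.le hs.2)

theorem intervalIntegrable_kernel_mul (hμ : IsGrowingKernel μ θ) {k : ℝ → ℝ} {t a b : ℝ}
    (hk : IntervalIntegrable k volume a b) :
    IntervalIntegrable (fun s => cumulative μ (t - s) * k s) volume a b := by
  rw [intervalIntegrable_iff] at hk ⊢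
  refine Integrable.bdd_mul (c := cumulative μ (t - min a b)) hk
    ((measurable_cumulative hμ).comp (by fun_prop)).aestronglyMeasurable ?_
  filter_upwards [ae_restrict_mem measurableSet_uIoc] with s hs
  rw [Real.norm_of_nonneg (cumulative_nonneg μ _)]
  exact cumulative_mono hμ.finite (by linarith [hs.1])

/-- The Beta integral, for exponents that make the integrand bounded. -/
theorem integral_rpow_mul_rpow {a b : ℝ} (ha : 0 ≤ a) (hb : 0 ≤ b) :
    ∫ r in (0 : ℝ)..1, (1 - r) ^ a * r ^ b = ProbabilityTheory.beta (1 + a) (1 + b) := by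
  have hsymm : ProbabilityTheory.beta (1 + a) (1 + b) = ProbabilityTheory.beta (1 + b) (1 + a) := by
    rw [ProbabilityTheory.beta, ProbabilityTheory.beta, mul_comm, add_comm (1 + a)]
  rw [hsymm, ProbabilityTheory.beta_eq_betaIntegralReal _ _ (by linarith) (by linarith),
    Complex.betaIntegral]
  have : ∫ r in (0 : ℝ)..1, (r : ℂ) ^ (((1 + b : ℝ) : ℂ) - 1) *
      (1 - (r : ℂ)) ^ (((1 + a : ℝ) : ℂ) - 1) =
      ∫ r in (0 : ℝ)..1, (((1 - r) ^ a * r ^ b : ℝ) : ℂ) := by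
    refine intervalIntegral.integral_congr fun r hr => ?_
    rw [uIcc_of_le zero_le_one] at hr
    push_cast
    rw [Complex.ofReal_cpow (by linarith [hr.2]), Complex.ofReal_cpow hr.1]
    push_cast
    rw [add_sub_cancel_left, add_sub_cancel_left, mul_comm]
  rw [this, intervalIntegral.integral_ofReal, Complex.ofReal_re]

theorem K_pos (hθ : 0 ≤ θ) (hf : IsSublinearGrowth f β) : 0 < K θ β := by
  have := hf.one_sub_pos
  have := mul_nonneg hθ hf.nonneg
  exact div_pos (ProbabilityTheory.beta_pos (by linarith) (by positivity)) ‹_›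

/-- `∫_0^t M(t - s) f(G(s)) ds ∼ K G(t)`. -/
theorem tendsto_volterra_comp_scale (hμ : IsGrowingKernel μ θ) (hf : IsSublinearGrowth f β) :
    Tendsto (fun t => volterra μ (fun s => f (scale μ f s)) t / scale μ f t) atTop
      (𝓝 (K θ β)) := by
  obtain ⟨g, hg, heq⟩ := exists_measurable_eq_comp_scale hμ hf
  obtain ⟨C, hC, hmono⟩ := hf.exists_almost_monotone one_pos
  set γ := (1 + θ) / (1 - β) * β with hγ
  have hγ0 : 0 ≤ γ := by
    have := hμ.nonneg; have := hf.nonneg; have := hf.one_sub_pos; positivity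
  have hlim : Tendsto (fun t => ∫ r in Ioc (0 : ℝ) 1,
      cumulative μ (t * (1 - r)) / cumulative μ t * (g (r * t) / g t)) atTop
      (𝓝 (∫ r in Ioc (0 : ℝ) 1, (1 - r) ^ θ * r ^ γ)) := by
    refine tendsto_integral_filter_of_dominated_convergence (fun _ => C) ?_ ?_ ?_ ?_
    · refine Eventually.of_forall fun t => Measurable.aestronglyMeasurable ?_
      exact (((measurable_cumulative hμ).comp (by fun_prop)).div_const _).mul
        ((hg.comp (by fun_prop)).div_const _)
    · filter_upwards [eventually_gt_atTop 0, hμ.tendsto.eventually (eventually_gt_atTop 0)]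
        with t ht hMt
      filter_upwards [ae_restrict_mem measurableSet_Ioc] with r hr
      have hrt : 0 ≤ r * t := mul_nonneg hr.1.le ht.le
      rw [← heq _ hrt, ← heq _ ht.le]
      have h1 := hf.pos _ (scale_pos (μ := μ) hf hrt)
      have h2 := hf.pos _ (scale_pos (μ := μ) hf ht.le)
      have h3 := cumulative_nonneg μ (t * (1 - r))
      rw [Real.norm_of_nonneg (by positivity)]
      have e1 : cumulative μ (t * (1 - r)) / cumulative μ t ≤ 1 :=
        (div_le_one hMt).2 (cumulative_mono hμ.finite (by nlinarith [hr.1]))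
      have e2 : f (scale μ f (r * t)) / f (scale μ f t) ≤ C :=
        (div_le_iff₀ h2).2 (hmono _ _ (one_le_scale hf hrt)
          (scale_mono hμ hf hrt (by nlinarith [hr.2])))
      calc _ ≤ 1 * C := by gcongr
        _ = C := one_mul C
    · exact integrable_const C
    -- `r = 1` is excluded, as regular variation of `M` says nothing about `M(0) / M(t)`
    · have hne : ∀ᵐ r ∂(volume.restrict (Ioc (0 : ℝ) 1)), r ≠ 1 :=
        ae_restrict_of_ae (Measure.ae_ne volume 1)
      filter_upwards [ae_restrict_mem measurableSet_Ioc, hne] with r hr hr1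
      have hr1' : 0 < 1 - r := sub_pos.2 (lt_of_le_of_ne hr.2 hr1)
      refine Tendsto.mul ?_ ?_
      · simpa only [mul_comm] using hμ.regular.tendsto_div (1 - r) hr1'
      · refine (tendsto_comp_scale_div hμ hf hr.1).congr' ?_
        filter_upwards [eventually_ge_atTop 0] with t ht
        rw [heq _ ht, heq _ (mul_nonneg hr.1.le ht)]
  rw [← intervalIntegral.integral_of_le zero_le_one, integral_rpow_mul_rpow hμ.nonneg hγ0] at hlim
  have hK : ProbabilityTheory.beta (1 + θ) (1 + γ) * (1 / (1 - β)) = K θ β := by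
    rw [K, mul_one_div]
    congr 2
    have := hf.one_sub_pos.ne'
    rw [hγ]
    field_simp
    ring
  have hprod := hlim.mul (tendsto_mul_comp_scale_div hμ hf)
  rw [hK] at hprod
  refine hprod.congr' ?_
  filter_upwards [eventually_gt_atTop 0, hμ.tendsto.eventually (eventually_gt_atTop 0)] with t ht hMt
  have h2 := hf.pos _ (scale_pos (μ := μ) hf ht.le)
  have h3 := scale_pos (μ := μ) hf ht.le
  have hvol : volterra μ (fun s => f (scale μ f s)) t =
      t * ∫ r in (0 : ℝ)..1, cumulative μ (t * (1 - r)) * g (r * t) := by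
    have e := intervalIntegral.integral_comp_mul_right (a := 0) (b := 1)
      (fun s => cumulative μ (t - s) * g s) ht.ne'
    rw [zero_mul, one_mul, smul_eq_mul] at e
    have e' : volterra μ (fun s => f (scale μ f s)) t =
        ∫ s in (0 : ℝ)..t, cumulative μ (t - s) * g s := by
      refine intervalIntegral.integral_congr fun s hs => ?_
      rw [uIcc_of_le ht.le] at hs
      simp only [heq s hs.1]
    have e'' : ∀ r : ℝ, t * (1 - r) = t - r * t := fun r => by ring
    simp only [e'']
    rw [e, e', mul_inv_cancel_left₀ ht.ne']
  rw [hvol, ← intervalIntegral.integral_of_le zero_le_one]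
  have hint : ∫ r in (0 : ℝ)..1, cumulative μ (t * (1 - r)) / cumulative μ t * (g (r * t) / g t) =
      (∫ r in (0 : ℝ)..1, cumulative μ (t * (1 - r)) * g (r * t)) / (cumulative μ t * g t) := by
    rw [← intervalIntegral.integral_div]
    refine intervalIntegral.integral_congr fun r _ => ?_
    simp only [div_mul_div_comm]
  rw [hint, heq t ht.le]
  rw [heq t ht.le] at h2
  field_simp

/-- Changing the integrand on a bounded set costs at most a multiple of `M(t)`. -/
theorem exists_volterra_le_add (hμ : IsGrowingKernel μ θ) {k₁ k₂ : ℝ → ℝ}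
    (h₁ : ∀ t, 0 ≤ t → IntervalIntegrable k₁ volume 0 t)
    (h₂ : ∀ t, 0 ≤ t → IntervalIntegrable k₂ volume 0 t)
    (hle : ∀ᶠ s in atTop, k₁ s ≤ k₂ s) :
    ∃ D, ∀ᶠ t in atTop, volterra μ k₁ t ≤ D * cumulative μ t + volterra μ k₂ t := by
  obtain ⟨T, hT⟩ := eventually_atTop.1 (hle.and (eventually_ge_atTop 0))
  have hT0 : 0 ≤ T := (hT T le_rfl).2
  refine ⟨∫ s in (0 : ℝ)..T, |k₁ s - k₂ s|, ?_⟩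
  filter_upwards [eventually_ge_atTop T] with t ht
  have ht0 := hT0.trans ht
  have hi : ∀ a b : ℝ, 0 ≤ a → 0 ≤ b →
      IntervalIntegrable (fun s => k₁ s - k₂ s) volume a b := fun a b ha hb =>
    ((h₁ a ha).symm.trans (h₁ b hb)).sub ((h₂ a ha).symm.trans (h₂ b hb))
  have hsub : volterra μ k₁ t - volterra μ k₂ t =
      ∫ s in (0 : ℝ)..t, cumulative μ (t - s) * (k₁ s - k₂ s) := by
    rw [volterra, volterra, ← intervalIntegral.integral_sub
      (intervalIntegrable_kernel_mul hμ (h₁ t ht0)) (intervalIntegrable_kernel_mul hμ (h₂ t ht0))]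
    simp only [mul_sub]
  rw [← intervalIntegral.integral_add_adjacent_intervals
    (intervalIntegrable_kernel_mul hμ (hi 0 T le_rfl hT0))
    (intervalIntegrable_kernel_mul hμ (hi T t hT0 ht0))] at hsub
  have e1 : ∫ s in (0 : ℝ)..T, cumulative μ (t - s) * (k₁ s - k₂ s) ≤
      ∫ s in (0 : ℝ)..T, cumulative μ t * |k₁ s - k₂ s| := by
    refine intervalIntegral.integral_mono_on hT0
      (intervalIntegrable_kernel_mul hμ (hi 0 T le_rfl hT0))
      ((hi 0 T le_rfl hT0).abs.const_mul _) fun s hs => ?_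
    calc _ ≤ cumulative μ (t - s) * |k₁ s - k₂ s| :=
        mul_le_mul_of_nonneg_left (le_abs_self _) (cumulative_nonneg μ _)
      _ ≤ _ := mul_le_mul_of_nonneg_right (cumulative_mono hμ.finite (by linarith [hs.1]))
        (abs_nonneg _)
  have e2 : ∫ s in T..t, cumulative μ (t - s) * (k₁ s - k₂ s) ≤ ∫ s in T..t, (0 : ℝ) := by
    refine intervalIntegral.integral_mono_on ht
      (intervalIntegrable_kernel_mul hμ (hi T t hT0 ht0)) (by simp) fun s hs => ?_
    exact mul_nonpos_of_nonneg_of_nonpos (cumulative_nonneg μ _) (sub_nonpos.2 (hT s hs.1).1)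
  rw [intervalIntegral.integral_const_mul] at e1
  rw [intervalIntegral.integral_zero] at e2
  linarith

theorem volterra_const_mul (μ : Measure ℝ) (c : ℝ) (k : ℝ → ℝ) (t : ℝ) :
    volterra μ (fun s => c * k s) t = c * volterra μ k t := by
  rw [volterra, volterra, ← intervalIntegral.integral_const_mul]
  simp only [mul_left_comm]

theorem eventually_volterra_div_lt (hμ : IsGrowingKernel μ θ) (hf : IsSublinearGrowth f β)
    {k : ℝ → ℝ} (hk : ∀ t, 0 ≤ t → IntervalIntegrable k volume 0 t) {c d : ℝ}
    (hle : ∀ᶠ s in atTop, k s ≤ c * f (scale μ f s)) (hd : c * K θ β < d) :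
    ∀ᶠ t in atTop, volterra μ k t / scale μ f t < d := by
  obtain ⟨D, hD⟩ := exists_volterra_le_add hμ hk
    (fun t ht => (intervalIntegrable_comp_scale hμ hf ht).const_mul c) hle
  have hlim := ((tendsto_cumulative_div_scale hμ hf).const_mul D).add
    ((tendsto_volterra_comp_scale hμ hf).const_mul c)
  rw [mul_zero, zero_add] at hlim
  filter_upwards [hD, hlim.eventually (gt_mem_nhds hd), eventually_ge_atTop 0] with t h1 h2 ht
  rw [volterra_const_mul] at h1
  refine lt_of_le_of_lt ?_ h2
  rw [← mul_div_assoc, ← mul_div_assoc, ← add_div]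
  have := scale_pos (μ := μ) hf ht
  gcongr

theorem eventually_lt_volterra_div (hμ : IsGrowingKernel μ θ) (hf : IsSublinearGrowth f β)
    {k : ℝ → ℝ} (hk : ∀ t, 0 ≤ t → IntervalIntegrable k volume 0 t) {c d : ℝ}
    (hle : ∀ᶠ s in atTop, c * f (scale μ f s) ≤ k s) (hd : d < c * K θ β) :
    ∀ᶠ t in atTop, d < volterra μ k t / scale μ f t := by
  have h := eventually_volterra_div_lt hμ hf (k := fun s => -1 * k s) (c := -c) (d := -d)
    (fun t ht => (hk t ht).const_mul _) (hle.mono fun s hs => by linarith) (by linarith)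
  filter_upwards [h] with t ht
  rw [volterra_const_mul, mul_div_assoc] at ht
  linarith

end Scale

/-! ### A priori bounds -/

theorem volterra_mono {μ : Measure ℝ} {θ : ℝ} (hμ : IsGrowingKernel μ θ) {k : ℝ → ℝ}
    (hk : ∀ t, 0 ≤ t → IntervalIntegrable k volume 0 t) (hk0 : ∀ t, 0 ≤ t → 0 ≤ k t)
    {s t : ℝ} (hs : 0 ≤ s) (hst : s ≤ t) : volterra μ k s ≤ volterra μ k t := by
  have ht := hs.trans hst
  have hi := intervalIntegrable_kernel_mul (t := t) hμ (hk s hs)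
  have hi' := intervalIntegrable_kernel_mul (t := t) hμ ((hk s hs).symm.trans (hk t ht))
  have e1 : volterra μ k s ≤ ∫ u in (0 : ℝ)..s, cumulative μ (t - u) * k u :=
    intervalIntegral.integral_mono_on hs (intervalIntegrable_kernel_mul hμ (hk s hs)) hi
      fun u hu => mul_le_mul_of_nonneg_right (cumulative_mono hμ.finite (by linarith)) (hk0 u hu.1)
  have e2 : 0 ≤ ∫ u in s..t, cumulative μ (t - u) * k u :=
    intervalIntegral.integral_nonneg hst fun u hu =>
      mul_nonneg (cumulative_nonneg μ _) (hk0 u (hs.trans hu.1))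
  have e3 := intervalIntegral.integral_add_adjacent_intervals hi hi'
  rw [volterra] at e1 ⊢
  rw [volterra]
  linarith

theorem mul_le_volterra {μ : Measure ℝ} {θ : ℝ} (hμ : IsGrowingKernel μ θ) {k : ℝ → ℝ}
    (hk : ∀ t, 0 ≤ t → IntervalIntegrable k volume 0 t) (hk0 : ∀ t, 0 ≤ t → 0 ≤ k t)
    {a b t κ : ℝ} (ha : 0 ≤ a) (hab : a ≤ b) (hbt : b ≤ t) (hκ : ∀ s ∈ Icc a b, κ ≤ k s)
    (hκ0 : 0 ≤ κ) : (b - a) * cumulative μ (t - b) * κ ≤ volterra μ k t := by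
  have hb := ha.trans hab
  have ht := hb.trans hbt
  have hi : ∀ u v : ℝ, 0 ≤ u → 0 ≤ v →
      IntervalIntegrable (fun s => cumulative μ (t - s) * k s) volume u v := fun u v hu hv =>
    intervalIntegrable_kernel_mul hμ ((hk u hu).symm.trans (hk v hv))
  have hnn : ∀ u v : ℝ, 0 ≤ u → u ≤ v → 0 ≤ ∫ s in u..v, cumulative μ (t - s) * k s :=
    fun u v hu huv => intervalIntegral.integral_nonneg huv fun s hs =>
      mul_nonneg (cumulative_nonneg μ _) (hk0 s (hu.trans hs.1))
  have e1 : ∫ _s in a..b, cumulative μ (t - b) * κ ≤ ∫ s in a..b, cumulative μ (t - s) * k s :=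
    intervalIntegral.integral_mono_on hab (by simp) (hi a b ha hb) fun s hs =>
      mul_le_mul (cumulative_mono hμ.finite (by linarith [hs.2])) (hκ s hs) hκ0
        (cumulative_nonneg μ _)
  rw [intervalIntegral.integral_const, smul_eq_mul] at e1
  have e2 := intervalIntegral.integral_add_adjacent_intervals (hi 0 a le_rfl ha) (hi a b ha hb)
  have e3 := intervalIntegral.integral_add_adjacent_intervals (hi 0 b le_rfl hb) (hi b t hb ht)
  have e4 := hnn 0 a le_rfl ha
  have e5 := hnn b t hb hbt
  rw [volterra]
  linarith

theorem volterra_le_mul {μ : Measure ℝ} {θ : ℝ} (hμ : IsGrowingKernel μ θ) {k : ℝ → ℝ}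
    {t κ : ℝ} (ht : 0 ≤ t) (hk : IntervalIntegrable k volume 0 t)
    (hκ : ∀ s ∈ Icc 0 t, k s ≤ κ) (hκ0 : 0 ≤ κ) :
    volterra μ k t ≤ t * cumulative μ t * κ := by
  have e1 : volterra μ k t ≤ ∫ _s in (0 : ℝ)..t, cumulative μ t * κ := by
    refine intervalIntegral.integral_mono_on ht (intervalIntegrable_kernel_mul hμ hk) (by simp)
      fun s hs => ?_
    exact (mul_le_mul_of_nonneg_left (hκ s hs) (cumulative_nonneg μ _)).trans
      (mul_le_mul_of_nonneg_right (cumulative_mono hμ.finite (by linarith [hs.1])) hκ0)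
  rw [intervalIntegral.integral_const, smul_eq_mul, sub_zero, ← mul_assoc] at e1
  exact e1

/-- `x` is continuous and bounded below by `ξ > 0` on `[0, ∞)` and satisfies
`x(t) = ξ + ∫_0^t M(t - s) f(x(s)) ds + H(t)` for `t > 0`, with `H > 0`. -/
structure IsIntegralSolution (μ : Measure ℝ) (f H : ℝ → ℝ) (ξ : ℝ) (x : ℝ → ℝ) : Prop where
  continuousOn : ContinuousOn x (Ici 0)
  initial_pos : 0 < ξ
  le : ∀ t, 0 ≤ t → ξ ≤ x t
  forcing_pos : ∀ t, 0 < t → 0 < H t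
  eq_add : ∀ t, 0 < t → x t = ξ + volterra μ (fun s => f (x s)) t + H t

namespace IsIntegralSolution

variable {μ : Measure ℝ} {f H x : ℝ → ℝ} {θ β ξ : ℝ}

theorem pos (hx : IsIntegralSolution μ f H ξ x) {t : ℝ} (ht : 0 ≤ t) : 0 < x t :=
  hx.initial_pos.trans_le (hx.le t ht)

theorem intervalIntegrable (hx : IsIntegralSolution μ f H ξ x) (hf : IsSublinearGrowth f β)
    (t : ℝ) (ht : 0 ≤ t) : IntervalIntegrable (fun s => f (x s)) volume 0 t := by
  refine ContinuousOn.intervalIntegrable ?_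
  rw [uIcc_of_le ht]
  exact hf.cont.comp (hx.continuousOn.mono Icc_subset_Ici_self) fun s hs => hx.pos hs.1

theorem comp_nonneg (hx : IsIntegralSolution μ f H ξ x) (hf : IsSublinearGrowth f β)
    (t : ℝ) (ht : 0 ≤ t) : 0 ≤ f (x t) := (hf.pos _ (hx.pos ht)).le

/-- The lower bound `x ≥ m G`. The function `Y = ξ + ∫_0^t M(t - s) f(x(s)) ds ≤ x` is increasing,
so `Y(t) ≥ (t / 4) M(t / 4) f(Y(t / 2)) / C₁`. Thus `Y ≥ m G` at `t / 2` implies `Y ≥ c₂ m ^ p G` at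
`t`, and `c₂ m ^ p ≥ m` for small `m` as `p < 1`. -/
theorem exists_mul_scale_le (hx : IsIntegralSolution μ f H ξ x) (hμ : IsGrowingKernel μ θ)
    (hf : IsSublinearGrowth f β) : ∃ m > 0, ∀ᶠ t in atTop, m * scale μ f t ≤ x t := by
  have hξ := hx.initial_pos
  have hy₀ : 0 < min ξ 1 := lt_min hξ one_pos
  obtain ⟨C₁, hC₁, hmono⟩ := hf.exists_almost_monotone hy₀
  obtain ⟨p, hp0, hp1, C₂, hC₂, hpot⟩ := hf.exists_potter hy₀
  let Y : ℝ → ℝ := fun t => ξ + volterra μ (fun s => f (x s)) t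
  have hint := hx.intervalIntegrable hf
  have hnn := hx.comp_nonneg hf
  have hYmono : ∀ s t, 0 ≤ s → s ≤ t → Y s ≤ Y t := fun s t hs hst =>
    add_le_add_right (volterra_mono hμ hint hnn hs hst) ξ
  have hY : ∀ t, 0 ≤ t → ξ ≤ Y t := fun t ht => by
    have := hYmono 0 t le_rfl ht
    simpa [Y, volterra] using this
  have hYx : ∀ t, 0 < t → Y t ≤ x t := fun t ht => by
    rw [hx.eq_add t ht]; exact le_add_of_nonneg_right (hx.forcing_pos t ht).le
  obtain ⟨c, hc, hcev⟩ : ∃ c > 0, ∀ᶠ t in atTop,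
      c * scale μ f t ≤ 1 / 4 * t * cumulative μ (1 / 4 * t) * f (scale μ f (1 / 2 * t)) := by
    have hlim := ((hμ.tendsto_mul_div (r := 1 / 4) (by norm_num)).mul
      (tendsto_comp_scale_div hμ hf (r := 1 / 2) (by norm_num))).mul
      (tendsto_mul_comp_scale_div hμ hf)
    have hpos : 0 < (1 / 4 : ℝ) ^ (1 + θ) * (1 / 2) ^ ((1 + θ) / (1 - β) * β) * (1 / (1 - β)) := by
      have := hf.one_sub_pos; positivity
    refine ⟨_, half_pos hpos, ?_⟩
    filter_upwards [hlim.eventually (lt_mem_nhds (half_lt_self hpos)), eventually_gt_atTop 0,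
      hμ.tendsto.eventually (eventually_gt_atTop 0)] with t h1 ht hM
    have hG := scale_pos (μ := μ) hf ht.le
    have hfG := hf.pos _ hG
    rw [← le_div_iff₀ hG]
    refine h1.le.trans_eq ?_
    field_simp
  set c₂ := c / ((C₁ + C₂) * C₁) with hc₂
  have hc₂0 : 0 < c₂ := by positivity
  obtain ⟨T, hT⟩ := eventually_atTop.1 (hcev.and (eventually_gt_atTop 0))
  have hT0 : 0 < T := (hT T le_rfl).2
  have hstep : ∀ m : ℝ, 0 < m → m ≤ 1 → ∀ t, T ≤ t → m * scale μ f (1 / 2 * t) ≤ Y (1 / 2 * t) →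
      c₂ * m ^ p * scale μ f t ≤ Y t := by
    intro m hm hm1 t ht hmY
    obtain ⟨h1, ht0⟩ := hT t ht
    have ht2 : 0 < 1 / 2 * t := by positivity
    set G := scale μ f (1 / 2 * t)
    set y := Y (1 / 2 * t)
    have hG1 : 1 ≤ G := one_le_scale hf ht2.le
    have hG0 : 0 < G := zero_lt_one.trans_le hG1
    have hyξ : ξ ≤ y := hY _ ht2.le
    have hy0 : 0 < y := hξ.trans_le hyξ
    have hfy := hf.pos y hy0
    have hfG : m ^ p * f G ≤ (C₁ + C₂) * f y := by
      rcases le_total G y with hle | hle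
      · calc m ^ p * f G ≤ 1 * (C₁ * f y) := by
              have := (hf.pos G hG0).le
              gcongr
              · exact Real.rpow_le_one hm.le hm1 hp0.le
              · exact hmono G y ((min_le_right _ _).trans hG1) hle
          _ ≤ _ := by nlinarith
      · have hGy : G / y ≤ m⁻¹ := by
          rw [div_le_iff₀ hy0, inv_mul_eq_div, le_div_iff₀ hm, mul_comm]; exact hmY
        calc m ^ p * f G ≤ m ^ p * (C₂ * (G / y) ^ p * f y) := by
              gcongr; exact hpot y G ((min_le_left _ _).trans hyξ) hle
          _ ≤ m ^ p * (C₂ * (m⁻¹) ^ p * f y) := by gcongr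
          _ = C₂ * f y := by
              rw [Real.inv_rpow hm.le]
              have := Real.rpow_pos_of_pos hm p
              field_simp
          _ ≤ _ := by nlinarith
    -- keep only `s ∈ [t / 2, 3 t / 4]`, where `M(t - s) ≥ M(t / 4)` and `x(s) ≥ Y(t / 2)`
    have hvol := mul_le_volterra hμ hint hnn (a := 1 / 2 * t) (b := 3 / 4 * t) (t := t)
      (κ := f y / C₁) ht2.le (by linarith) (by linarith) (fun s hs => by
        have hs0 : 0 < s := ht2.trans_le hs.1
        rw [div_le_iff₀' hC₁]
        exact hmono y (x s) ((min_le_left _ _).trans hyξ)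
          ((hYmono _ _ ht2.le hs.1).trans (hYx s hs0))) (by positivity)
    rw [show 3 / 4 * t - 1 / 2 * t = 1 / 4 * t by ring, show t - 3 / 4 * t = 1 / 4 * t by ring]
      at hvol
    have hM := mul_cumulative_nonneg μ (t := 1 / 4 * t) (by positivity)
    calc c₂ * m ^ p * scale μ f t = m ^ p / ((C₁ + C₂) * C₁) * (c * scale μ f t) := by
          rw [hc₂]; ring
      _ ≤ m ^ p / ((C₁ + C₂) * C₁) * (1 / 4 * t * cumulative μ (1 / 4 * t) * f G) := by gcongr
      _ = 1 / 4 * t * cumulative μ (1 / 4 * t) * (m ^ p * f G / (C₁ + C₂) / C₁) := by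
          field_simp
      _ ≤ 1 / 4 * t * cumulative μ (1 / 4 * t) * (f y / C₁) := by
          gcongr
          rw [div_le_iff₀' (by positivity)]; exact hfG
      _ ≤ volterra μ (fun s => f (x s)) t := hvol
      _ ≤ Y t := by simp only [Y]; linarith
  have hp1' : 0 < 1 - p := by linarith
  have hG2T : 0 < scale μ f (2 * T) := scale_pos hf (by linarith)
  obtain ⟨m, hm0, hm1, hmc, hmT⟩ : ∃ m : ℝ, 0 < m ∧ m ≤ 1 ∧ m ≤ c₂ ^ (1 / (1 - p)) ∧
      m * scale μ f (2 * T) ≤ ξ := by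
    refine ⟨min 1 (min (c₂ ^ (1 / (1 - p))) (ξ / scale μ f (2 * T))), by positivity,
      min_le_left _ _, (min_le_right _ _).trans (min_le_left _ _), ?_⟩
    rw [← le_div_iff₀ hG2T]
    exact (min_le_right _ _).trans (min_le_right _ _)
  have hmfix : m ≤ c₂ * m ^ p := by
    have h1 : m ^ (1 - p) ≤ c₂ := by
      calc m ^ (1 - p) ≤ (c₂ ^ (1 / (1 - p))) ^ (1 - p) := by gcongr
        _ = c₂ := by rw [← Real.rpow_mul hc₂0.le, one_div_mul_cancel hp1'.ne', Real.rpow_one]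
    calc m = m ^ (1 - p) * m ^ p := by rw [← Real.rpow_add hm0]; simp
      _ ≤ _ := by gcongr
  have hall : ∀ n : ℕ, ∀ t, T ≤ t → t ≤ 2 ^ (n + 1) * T → m * scale μ f t ≤ Y t := by
    intro n
    induction n with
    | zero =>
      intro t ht ht2
      have ht0 : 0 ≤ t := hT0.le.trans ht
      calc m * scale μ f t ≤ m * scale μ f (2 * T) := by
            gcongr; exact scale_mono hμ hf ht0 (by simpa using ht2)
        _ ≤ ξ := hmT
        _ ≤ Y t := hY t ht0
    | succ n ih =>
      intro t ht ht2
      rcases le_total t (2 ^ (n + 1) * T) with hle | hle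
      · exact ih t ht hle
      · have h2T : 2 * T ≤ t := by
          refine le_trans ?_ hle
          gcongr
          exact le_self_pow₀ (by norm_num) (by omega)
        have e := ih (1 / 2 * t) (by linarith) (by rw [pow_succ] at ht2; linarith)
        have hG := scale_pos (μ := μ) hf (hT0.le.trans ht)
        exact (mul_le_mul_of_nonneg_right hmfix hG.le).trans (hstep m hm0 hm1 t ht e)
  refine ⟨m, hm0, ?_⟩
  filter_upwards [eventually_ge_atTop T] with t ht
  obtain ⟨n, hn⟩ := pow_unbounded_of_one_lt (t / T) (by norm_num : (1 : ℝ) < 2)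
  rw [div_lt_iff₀ hT0] at hn
  refine (hall n t ht (hn.le.trans ?_)).trans (hYx t (hT0.trans_le ht))
  gcongr
  · norm_num
  · omega

/-- The upper bound `x ≤ R G`. At a time `s` where `x` attains its maximum over `[0, s]`, the
convolution is at most `s M(s) C₁ f(x(s))`, which by Potter's bound is `O(ρ ^ p G(s))` with
`ρ = x(s) / G(s)`; hence `ρ = O(ρ ^ p)` and `ρ` is bounded. -/
theorem exists_le_mul_scale (hx : IsIntegralSolution μ f H ξ x) (hμ : IsGrowingKernel μ θ)
    (hf : IsSublinearGrowth f β) {Λ : ℝ} (hH : ∀ᶠ t in atTop, H t ≤ Λ * scale μ f t) :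
    ∃ R, ∀ᶠ t in atTop, x t ≤ R * scale μ f t := by
  have hξ := hx.initial_pos
  have hy₀ : 0 < min ξ 1 := lt_min hξ one_pos
  obtain ⟨C₁, hC₁, hmono⟩ := hf.exists_almost_monotone hy₀
  obtain ⟨p, hp0, hp1, C₂, hC₂, hpot⟩ := hf.exists_potter hy₀
  have hp1' : 0 < 1 - p := by linarith
  have hβ := hf.one_sub_pos
  set A := 1 / (1 - β) + 1 with hA
  have hA0 : 0 < A := by positivity
  have hAev : ∀ᶠ t in atTop, t * cumulative μ t * f (scale μ f t) ≤ A * scale μ f t := by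
    filter_upwards [(tendsto_mul_comp_scale_div hμ hf).eventually
      (gt_mem_nhds (lt_add_one (1 / (1 - β)))), eventually_ge_atTop 0] with t ht ht0
    exact ((div_lt_iff₀ (scale_pos hf ht0)).1 ht).le
  obtain ⟨T, hT⟩ := eventually_atTop.1 ((hH.and hAev).and (eventually_gt_atTop 0))
  have hT0 : 0 < T := (hT T le_rfl).2
  set D := ξ + |Λ| + C₁ * C₂ * A with hD
  have hD0 : 0 < D := by positivity
  -- the bound at a time `s` where `x` attains its maximum over `[0, s]`
  have hmaxbound : ∀ s, T ≤ s → (∀ u ∈ Icc 0 s, x u ≤ x s) →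
      x s ≤ (1 + D ^ (1 / (1 - p))) * scale μ f s := by
    intro s hs hmax
    obtain ⟨⟨h1, h2⟩, hs0⟩ := hT s hs
    set G := scale μ f s
    have hG1 : 1 ≤ G := one_le_scale hf hs0.le
    have hG0 : 0 < G := zero_lt_one.trans_le hG1
    have hDp : 0 < D ^ (1 / (1 - p)) := by positivity
    rcases le_total (x s) G with hle | hle
    · nlinarith
    · set ρ := x s / G with hρ
      have hρ1 : 1 ≤ ρ := (one_le_div hG0).2 hle
      have hρ0 : 0 < ρ := by linarith
      have hρp : 1 ≤ ρ ^ p := Real.one_le_rpow hρ1 hp0.le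
      have hfx := hf.pos _ (hx.pos hs0.le)
      have hM := mul_cumulative_nonneg μ hs0.le
      have hvol := volterra_le_mul hμ hs0.le (hx.intervalIntegrable hf s hs0.le)
        (κ := C₁ * f (x s)) (fun u hu => hmono _ _ ((min_le_left _ _).trans (hx.le u hu.1))
          (hmax u hu)) (by positivity)
      have hfpot := hpot G (x s) ((min_le_right _ _).trans hG1) hle
      have hxs : x s ≤ ξ * G + C₁ * C₂ * A * ρ ^ p * G + |Λ| * G := by
        rw [hx.eq_add s hs0]
        refine add_le_add (add_le_add (by nlinarith) ?_) (h1.trans ?_)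
        · calc _ ≤ s * cumulative μ s * (C₁ * f (x s)) := hvol
            _ ≤ s * cumulative μ s * (C₁ * (C₂ * ρ ^ p * f G)) := by gcongr
            _ = C₁ * C₂ * ρ ^ p * (s * cumulative μ s * f G) := by ring
            _ ≤ C₁ * C₂ * ρ ^ p * (A * G) := by gcongr
            _ = _ := by ring
        · gcongr; exact le_abs_self Λ
      have hρle : ρ ≤ D * ρ ^ p := by
        rw [hρ, div_le_iff₀ hG0, ← hρ]
        refine hxs.trans ?_
        have e1 : ξ * G ≤ ξ * G * ρ ^ p := le_mul_of_one_le_right (by positivity) hρp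
        have e2 : |Λ| * G ≤ |Λ| * G * ρ ^ p := le_mul_of_one_le_right (by positivity) hρp
        rw [hD]
        linarith
      have hρD : ρ ^ (1 - p) ≤ D := by
        rw [Real.rpow_sub hρ0, Real.rpow_one, div_le_iff₀ (by positivity)]
        exact hρle
      have hρfin : ρ ≤ D ^ (1 / (1 - p)) := by
        calc ρ = (ρ ^ (1 - p)) ^ (1 / (1 - p)) := by
              rw [← Real.rpow_mul hρ0.le, mul_one_div_cancel hp1'.ne', Real.rpow_one]
          _ ≤ _ := by gcongr
      rw [hρ, div_le_iff₀ hG0] at hρfin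
      nlinarith
  obtain ⟨v, hv, hvmax⟩ := isCompact_Icc.exists_isMaxOn (nonempty_Icc.2 hT0.le)
    (hx.continuousOn.mono Icc_subset_Ici_self)
  refine ⟨1 + D ^ (1 / (1 - p)) + x v, ?_⟩
  filter_upwards [eventually_ge_atTop T] with t ht
  have ht0 := hT0.le.trans ht
  have hG1 : 1 ≤ scale μ f t := one_le_scale hf ht0
  have hDp : 0 < D ^ (1 / (1 - p)) := by positivity
  have hxv := hx.pos hv.1
  obtain ⟨s, hs, hsmax⟩ := isCompact_Icc.exists_isMaxOn (nonempty_Icc.2 ht0)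
    (hx.continuousOn.mono Icc_subset_Ici_self)
  have hts : x t ≤ x s := hsmax (⟨ht0, le_rfl⟩ : t ∈ Icc 0 t)
  rcases le_total T s with hTs | hTs
  · have e1 := hmaxbound s hTs fun u hu => hsmax (⟨hu.1, hu.2.trans hs.2⟩ : u ∈ Icc 0 t)
    have e2 := scale_mono hμ hf hs.1 hs.2
    nlinarith
  · have e1 : x s ≤ x v := hvmax (⟨hs.1, hTs⟩ : s ∈ Icc 0 T)
    nlinarith

/-! ### Identification of the limit -/

theorem tendsto_div_scale_zero (hμ : IsGrowingKernel μ θ) (hf : IsSublinearGrowth f β) (c : ℝ) :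
    Tendsto (fun t => c / scale μ f t) atTop (𝓝 0) :=
  tendsto_const_nhds.div_atTop (tendsto_scale_atTop hμ hf)

theorem eventually_div_scale_eq (hx : IsIntegralSolution μ f H ξ x) :
    ∀ᶠ t in atTop, x t / scale μ f t = ξ / scale μ f t +
      volterra μ (fun s => f (x s)) t / scale μ f t + H t / scale μ f t := by
  filter_upwards [eventually_gt_atTop 0] with t ht
  rw [← add_div, ← add_div, hx.eq_add t ht]

theorem tendsto_forcing_div (hx : IsIntegralSolution μ f H ξ x) (hμ : IsGrowingKernel μ θ)
    (hf : IsSublinearGrowth f β) {ζ : ℝ} (hζ : 0 < ζ)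
    (hlim : Tendsto (fun t => x t / scale μ f t) atTop (𝓝 ζ)) :
    Tendsto (fun t => H t / scale μ f t) atTop (𝓝 (ζ - ζ ^ β * K θ β)) := by
  have hK := K_pos hμ.nonneg hf
  have hcomp := hf.tendsto_comp_div hζ (tendsto_scale_atTop hμ hf) hlim
  have hfG : ∀ᶠ t in atTop, 0 < f (scale μ f t) := by
    filter_upwards [eventually_ge_atTop 0] with t ht using hf.pos _ (scale_pos hf ht)
  have hvol : Tendsto (fun t => volterra μ (fun s => f (x s)) t / scale μ f t) atTop
      (𝓝 (ζ ^ β * K θ β)) := by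
    refine tendsto_order.2 ⟨fun d hd => ?_, fun d hd => ?_⟩
    · obtain ⟨c, hc1, hc2⟩ := exists_between ((div_lt_iff₀ hK).2 hd)
      refine eventually_lt_volterra_div hμ hf (hx.intervalIntegrable hf) ?_ ((div_lt_iff₀ hK).1 hc1)
      filter_upwards [hcomp.eventually (lt_mem_nhds hc2), hfG] with t h1 h2
      exact ((lt_div_iff₀ h2).1 h1).le
    · obtain ⟨c, hc1, hc2⟩ := exists_between ((lt_div_iff₀ hK).2 hd)
      refine eventually_volterra_div_lt hμ hf (hx.intervalIntegrable hf) ?_ ((lt_div_iff₀ hK).1 hc2)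
      filter_upwards [hcomp.eventually (gt_mem_nhds hc1), hfG] with t h1 h2
      exact ((div_lt_iff₀ h2).1 h1).le
  have := (hlim.sub (tendsto_div_scale_zero hμ hf ξ)).sub hvol
  rw [sub_zero] at this
  refine this.congr' ?_
  filter_upwards [hx.eventually_div_scale_eq] with t ht
  rw [ht]; ring

end IsIntegralSolution

variable {μ : Measure ℝ} {f H x : ℝ → ℝ} {θ β ξ : ℝ}

theorem eventually_comp_le (hf : IsSublinearGrowth f β) {ι : Type*} {l : Filter ι} {u v : ι → ℝ}
    {m b c : ℝ} (hm : 0 < m) (hv : Tendsto v l atTop)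
    (hmu : ∀ᶠ t in l, m ≤ u t / v t) (hub : ∀ᶠ t in l, u t / v t ≤ b) (hb : 0 < b)
    (hc : b ^ β < c) : ∀ᶠ t in l, f (u t) ≤ c * f (v t) := by
  have hbp := Real.rpow_pos_of_pos hb β
  filter_upwards [hmu, hub, hv.eventually (eventually_gt_atTop 0),
    hv.eventually (hf.regular.eventually_uniform hf.cont hf.pos (a := m) (b := b) hm
      ((one_lt_div hbp).2 hc))] with t h1 h2 h3 h4
  have := (h4 _ ⟨h1, h2⟩).1
  rw [div_mul_cancel₀ _ h3.ne'] at this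
  have hfv := hf.pos _ h3
  have hcp : 0 < c := hbp.trans hc
  calc f (u t) ≤ c / b ^ β * (u t / v t) ^ β * f (v t) := this
    _ ≤ c / b ^ β * b ^ β * f (v t) := by
      have := hm.le.trans h1
      have := hf.nonneg
      gcongr
    _ = c * f (v t) := by rw [div_mul_cancel₀ _ hbp.ne']

theorem eventually_le_comp (hf : IsSublinearGrowth f β) {ι : Type*} {l : Filter ι} {u v : ι → ℝ}
    {a b c : ℝ} (ha : 0 < a) (hv : Tendsto v l atTop)
    (hau : ∀ᶠ t in l, a ≤ u t / v t) (hub : ∀ᶠ t in l, u t / v t ≤ b)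
    (hc0 : 0 < c) (hc : c < a ^ β) : ∀ᶠ t in l, c * f (v t) ≤ f (u t) := by
  filter_upwards [hau, hub, hv.eventually (eventually_gt_atTop 0),
    hv.eventually (hf.regular.eventually_uniform hf.cont hf.pos (a := a) (b := b) ha
      ((one_lt_div hc0).2 hc))] with t h1 h2 h3 h4
  have := (h4 _ ⟨h1, h2⟩).2
  rw [div_mul_cancel₀ _ h3.ne'] at this
  have hfv := hf.pos _ h3
  have hap := Real.rpow_pos_of_pos ha β
  have h5 : a ^ β * f (v t) ≤ a ^ β / c * f (u t) := by
    refine le_trans ?_ this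
    have := hf.nonneg
    gcongr
  rw [div_mul_eq_mul_div, le_div_iff₀ hc0, mul_assoc] at h5
  have := le_of_mul_le_mul_left h5 hap
  linarith

/-- A supersolution `a` of `z = κ z ^ β + lam` cannot lie strictly below a subsolution `b`, because
the right side divided by `z` is strictly decreasing. -/
theorem eq_of_fixedPoint_inequalities {β κ lam a b : ℝ} (hβ : β < 1) (hκ : 0 < κ) (hlam : 0 ≤ lam)
    (ha : 0 < a) (hab : a ≤ b) (h₁ : κ * a ^ β + lam ≤ a) (h₂ : b ≤ κ * b ^ β + lam) : a = b := by
  by_contra hne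
  have hlt : a < b := lt_of_le_of_ne hab hne
  have hb := ha.trans hlt
  have hstrict : b ^ (β - 1) < a ^ (β - 1) := Real.rpow_lt_rpow_of_neg ha hlt (by linarith)
  have e1 : κ * a ^ (β - 1) + lam / a ≤ 1 := by
    rw [Real.rpow_sub ha, Real.rpow_one, ← mul_div_assoc, ← add_div, div_le_one ha]; exact h₁
  have e2 : 1 ≤ κ * b ^ (β - 1) + lam / b := by
    rw [Real.rpow_sub hb, Real.rpow_one, ← mul_div_assoc, ← add_div, one_le_div hb]; exact h₂
  have e3 : lam / b ≤ lam / a := by gcongr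
  nlinarith

namespace IsIntegralSolution

/-- If `H / G → lam`, then `x / G` converges: its lower and upper limits are positive, finite, and
satisfy opposite inequalities for the limit equation. -/
theorem exists_tendsto_div_scale (hx : IsIntegralSolution μ f H ξ x) (hμ : IsGrowingKernel μ θ)
    (hf : IsSublinearGrowth f β) {lam : ℝ} (hlam : 0 ≤ lam)
    (hlim : Tendsto (fun t => H t / scale μ f t) atTop (𝓝 lam)) :
    ∃ ζ, 0 < ζ ∧ Tendsto (fun t => x t / scale μ f t) atTop (𝓝 ζ) ∧ ζ = K θ β * ζ ^ β + lam := by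
  have hK := K_pos hμ.nonneg hf
  have hG := tendsto_scale_atTop hμ hf
  have hG0 : ∀ᶠ t in atTop, 0 < scale μ f t := hG.eventually (eventually_gt_atTop 0)
  obtain ⟨m, hm, hmx⟩ := hx.exists_mul_scale_le hμ hf
  obtain ⟨R, hxR⟩ := hx.exists_le_mul_scale hμ hf (Λ := lam + 1) (by
    filter_upwards [hlim.eventually (gt_mem_nhds (lt_add_one lam)), hG0] with t h1 h2
    exact ((div_lt_iff₀ h2).1 h1).le)
  set r : ℝ → ℝ := fun t => x t / scale μ f t with hr
  have hmr : ∀ᶠ t in atTop, m ≤ r t := by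
    filter_upwards [hmx, hG0] with t h1 h2 using (le_div_iff₀ h2).2 h1
  have hrR : ∀ᶠ t in atTop, r t ≤ R := by
    filter_upwards [hxR, hG0] with t h1 h2 using (div_le_iff₀ h2).2 h1
  have hbdd : IsBoundedUnder (· ≤ ·) atTop r := ⟨R, hrR⟩
  have hbdd' : IsBoundedUnder (· ≥ ·) atTop r := ⟨m, hmr⟩
  have hrest : Tendsto (fun t => ξ / scale μ f t + H t / scale μ f t) atTop (𝓝 lam) := by
    simpa using (tendsto_div_scale_zero hμ hf ξ).add hlim
  set a := liminf r atTop with ha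
  set b := limsup r atTop with hb
  have hma : m ≤ a := le_liminf_of_le hbdd.isCoboundedUnder_ge hmr
  have hab : a ≤ b := liminf_le_limsup hbdd hbdd'
  have ha0 : 0 < a := hm.trans_le hma
  have hb0 : 0 < b := ha0.trans_le hab
  have hupper : b ≤ K θ β * b ^ β + lam := by
    have hstep : ∀ b', b < b' → b ≤ K θ β * b' ^ β + lam := by
      intro b' hb'
      refine le_of_forall_gt_imp_ge_of_dense fun e he => ?_
      obtain ⟨d, hd1, hd2⟩ := exists_between (lt_sub_iff_add_lt.2 he)
      obtain ⟨c, hc1, hc2⟩ := exists_between ((lt_div_iff₀' hK).2 hd1)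
      have hrb : ∀ᶠ t in atTop, r t ≤ b' :=
        (eventually_lt_of_limsup_lt hb' hbdd).mono fun t ht => ht.le
      have h1 := eventually_volterra_div_lt hμ hf (hx.intervalIntegrable hf)
        (eventually_comp_le hf hm hG hmr hrb (hb0.trans hb') hc1) ((lt_div_iff₀ hK).1 hc2)
      have h2 := hrest.eventually (gt_mem_nhds (show lam < e - d by linarith))
      refine limsup_le_of_le hbdd'.isCoboundedUnder_le ?_
      filter_upwards [h1, h2, hx.eventually_div_scale_eq] with t e1 e2 e3
      simp only [hr]
      linarith
    have hcont : Tendsto (fun b' => K θ β * b' ^ β + lam) (𝓝[>] b) (𝓝 (K θ β * b ^ β + lam)) :=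
      (((Real.continuousAt_rpow_const b β (Or.inl hb0.ne')).tendsto.const_mul _).add_const
        _).mono_left nhdsWithin_le_nhds
    exact ge_of_tendsto hcont (eventually_mem_of_tendsto_nhdsWithin tendsto_id |>.mono hstep)
  have hlower : K θ β * a ^ β + lam ≤ a := by
    have hstep : ∀ a', 0 < a' → a' < a → K θ β * a' ^ β + lam ≤ a := by
      intro a' ha'0 ha'
      refine le_of_forall_lt_imp_le_of_dense fun e he => ?_
      obtain ⟨d, hd1, hd2⟩ := exists_between (sub_lt_iff_lt_add.2 he)
      have hap := Real.rpow_pos_of_pos ha'0 β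
      obtain ⟨c, hc1, hc2⟩ := exists_between (max_lt ((div_lt_iff₀' hK).2 hd2) hap)
      have hra : ∀ᶠ t in atTop, a' ≤ r t :=
        (eventually_lt_of_lt_liminf ha' hbdd').mono fun t ht => ht.le
      have h1 := eventually_lt_volterra_div hμ hf (hx.intervalIntegrable hf)
        (eventually_le_comp hf ha'0 hG hra hrR ((le_max_right _ _).trans_lt hc1) hc2)
        ((div_lt_iff₀ hK).1 ((le_max_left _ _).trans_lt hc1))
      have h2 := hrest.eventually (lt_mem_nhds (show e - d < lam by linarith))
      refine le_liminf_of_le hbdd.isCoboundedUnder_ge ?_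
      filter_upwards [h1, h2, hx.eventually_div_scale_eq] with t e1 e2 e3
      simp only [hr]
      linarith
    have hcont : Tendsto (fun a' => K θ β * a' ^ β + lam) (𝓝[<] a) (𝓝 (K θ β * a ^ β + lam)) :=
      (((Real.continuousAt_rpow_const a β (Or.inl ha0.ne')).tendsto.const_mul _).add_const
        _).mono_left nhdsWithin_le_nhds
    refine le_of_tendsto hcont ?_
    filter_upwards [Ioo_mem_nhdsLT ha0] with a' ha' using hstep a' ha'.1 ha'.2
  have heq := eq_of_fixedPoint_inequalities hf.lt_one hK hlam ha0 hab hlower hupper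
  refine ⟨a, ha0, tendsto_of_liminf_eq_limsup rfl heq.symm hbdd hbdd', le_antisymm ?_ hlower⟩
  rwa [← heq] at hupper

end IsIntegralSolution

theorem IsSolution.isIntegralSolution {μ : Measure ℝ} {f h x : ℝ → ℝ} {θ β ξ : ℝ}
    (hx : IsSolution μ f h ξ x) (hμ : IsGrowingKernel μ θ) (hf : IsSublinearGrowth f β)
    (hh : ∀ T : ℝ, 0 < T → IntervalIntegrable h volume 0 T)
    (hH : ∀ t : ℝ, 0 < t → 0 < forcing h t) (hξ : 0 < ξ) :
    IsIntegralSolution μ f (forcing h) ξ x where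
  continuousOn := hx.continuousOn
  initial_pos := hξ
  le t ht := by
    rcases ht.eq_or_lt with rfl | ht'
    · exact hx.initial.ge
    · rw [hx.eq_add hμ.finite hf.cont hh ht']
      have : 0 ≤ volterra μ (fun s => f (x s)) t :=
        intervalIntegral.integral_nonneg ht fun s hs =>
          mul_nonneg (cumulative_nonneg μ _) (hf.pos _ (hx.pos s hs.1)).le
      linarith [hH t ht']
  forcing_pos := hH
  eq_add t ht := hx.eq_add hμ.finite hf.cont hh ht

end SublinearVolterra

theorem theorem3p1
    (μ : Measure ℝ) (hμ_neg : μ (Iio 0) = 0) (hμ_fin : ∀ t : ℝ, μ (Icc 0 t) < ⊤)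
    (hμ_inf : Tendsto (SublinearVolterra.cumulative μ) atTop atTop)
    (θ : ℝ) (hθ : 0 ≤ θ)
    (hM : SublinearVolterra.IsRegularlyVarying (SublinearVolterra.cumulative μ) θ)
    (f : ℝ → ℝ) (hf_cont : ContinuousOn f (Ioi 0)) (hf_pos : ∀ y : ℝ, 0 < y → 0 < f y)
    (β : ℝ) (hβ : β ∈ Ico (0 : ℝ) 1)
    (hf : SublinearVolterra.IsRegularlyVarying f β)
    (hf_zero : β = 0 → SublinearVolterra.AsymptoticallyIncreasing f ∧ Tendsto f atTop atTop)
    (h : ℝ → ℝ) (hh : ∀ T : ℝ, 0 < T → IntervalIntegrable h volume 0 T)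
    (hH : ∀ t : ℝ, 0 < t → 0 < SublinearVolterra.forcing h t)
    (ξ : ℝ) (hξ : 0 < ξ)
    (x : ℝ → ℝ) (hx : SublinearVolterra.IsSolution μ f h ξ x) :
    ((∃ ζ : ℝ, SublinearVolterra.L θ β ≤ ζ ∧
        Tendsto (fun t => x t /
          SublinearVolterra.Finv f (t * SublinearVolterra.cumulative μ t)) atTop (𝓝 ζ)) ↔
      (∃ lam : ℝ, 0 ≤ lam ∧
        Tendsto (fun t => SublinearVolterra.forcing h t /
          SublinearVolterra.Finv f (t * SublinearVolterra.cumulative μ t)) atTop (𝓝 lam))) ∧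
    (∀ ζ lam : ℝ,
      Tendsto (fun t => x t /
        SublinearVolterra.Finv f (t * SublinearVolterra.cumulative μ t)) atTop (𝓝 ζ) →
      Tendsto (fun t => SublinearVolterra.forcing h t /
        SublinearVolterra.Finv f (t * SublinearVolterra.cumulative μ t)) atTop (𝓝 lam) →
      ζ = ζ ^ β / (1 - β) *
          ProbabilityTheory.beta (1 + θ) ((1 + θ * β) / (1 - β)) + lam ∧
      ∀ z : ℝ, 0 < z →
        z = z ^ β / (1 - β) *
          ProbabilityTheory.beta (1 + θ) ((1 + θ * β) / (1 - β)) + lam → z = ζ) := by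
  have hf' : SublinearVolterra.IsSublinearGrowth f β :=
    ⟨hf_cont, hf_pos, hβ.1, hβ.2, hf, fun h0 => (hf_zero h0).1⟩
  have hμ : SublinearVolterra.IsGrowingKernel μ θ := ⟨hμ_fin, hμ_inf, hθ, hM⟩
  have hx' := hx.isIntegralSolution hμ hf' hh hH hξ
  have hK := SublinearVolterra.K_pos hθ hf'
  have h1β := hf'.one_sub_pos
  have hlam_nonneg : ∀ lam : ℝ, Tendsto (fun t => SublinearVolterra.forcing h t /
      SublinearVolterra.scale μ f t) atTop (𝓝 lam) → 0 ≤ lam := by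
    intro lam hlam
    refine ge_of_tendsto hlam ?_
    filter_upwards [eventually_gt_atTop 0] with t ht
    exact (div_pos (hH t ht) (SublinearVolterra.scale_pos hf' ht.le)).le
  have hKform : ∀ z : ℝ, z ^ β / (1 - β) * ProbabilityTheory.beta (1 + θ) ((1 + θ * β) / (1 - β)) =
      SublinearVolterra.K θ β * z ^ β := by
    intro z; rw [SublinearVolterra.K]; ring
  refine ⟨⟨?_, ?_⟩, ?_⟩
  · rintro ⟨ζ, hζ, hlim⟩
    have hζ0 : 0 < ζ := (Real.rpow_pos_of_pos hK _).trans_le hζ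
    have hlam := hx'.tendsto_forcing_div hμ hf' hζ0 hlim
    exact ⟨_, hlam_nonneg _ hlam, hlam⟩
  · rintro ⟨lam, hlam, hlim⟩
    obtain ⟨ζ, hζ0, hζ, heq⟩ := hx'.exists_tendsto_div_scale hμ hf' hlam hlim
    refine ⟨ζ, ?_, hζ⟩
    have hle : SublinearVolterra.K θ β ≤ ζ ^ (1 - β) := by
      rw [Real.rpow_sub hζ0, Real.rpow_one, le_div_iff₀ (Real.rpow_pos_of_pos hζ0 β)]
      linarith
    calc SublinearVolterra.L θ β ≤ (ζ ^ (1 - β)) ^ (1 / (1 - β)) :=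
          Real.rpow_le_rpow hK.le hle (by positivity)
      _ = ζ := by rw [← Real.rpow_mul hζ0.le, mul_one_div_cancel h1β.ne', Real.rpow_one]
  · intro ζ lam hζ hlim
    have hlam := hlam_nonneg lam hlim
    obtain ⟨ζ', hζ0, hζ', heq⟩ := hx'.exists_tendsto_div_scale hμ hf' hlam hlim
    obtain rfl : ζ = ζ' := tendsto_nhds_unique hζ hζ'
    rw [hKform]
    refine ⟨heq, fun z hz hzeq => ?_⟩
    rw [hKform] at hzeq
    rcases le_total z ζ with hle | hle
    · exact SublinearVolterra.eq_of_fixedPoint_inequalities hβ.2 hK hlam hz hle hzeq.ge heq.le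
    · exact (SublinearVolterra.eq_of_fixedPoint_inequalities hβ.2 hK hlam hζ0 hle heq.ge
        hzeq.le).symm
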